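/- **Conventions.** Fix a set $S$ of signals. *Scott booleans* are $\bot,+,-$ with the flat order $\bot<+$, $\bot<-$; $\wedge,\vee,\neg$ are the parallel (Kleene) operations ($-\wedge x=x\wedge-=-$, $+\vee x=x\vee+=+$). An *event* $E$ is a partial map from $S$ to Scott booleans with domain $\mathrm{dom}(E)$; $E(s):=\bot$ for $s\notin\mathrm{dom}(E)$; $E\le E'$ means $E(s)\le E'(s)$ for all $s$; $s^b*E$ is $E$ with $s$ (re)bound to $b$. *Statements* (loop-free Kernel Esterel): $p ::= \mathsf{nothing}\mid\mathsf{pause}\mid\mathsf{exit}\,n\mid\,!s\mid\mathsf{await}\,s\mid\{p\}\mid\,\uparrow p\mid \mathsf{susp}\,s\,p\mid s?p,q\mid p;q\mid p\,|\,q\mid p\backslash s$ (completion code of $\mathsf{exit}\,n$: $n+2$; $\{p\}$ is a trap, $\uparrow p$ a shift, $p\backslash s$ a local signal declaration). *States* are statements with marks on active $\mathsf{pause}$/$\mathsf{await}$ statements: $\hat{\mathsf{pause}}$ and $\hat{\mathsf{await}}\,s$ are states, all unary constructs are states when their body is, in $s?p,q$ and $p;q$ exactly one part is a state, in $p\,|\,q$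 at least one is. $\mathrm{base}(\cdot)$ erases marks. A *term* is a statement or a state. An *input color* is a triple (Go, Res, Susp) of Scott booleans, ordered componentwise. An *output color* is $\mathrm{B}_k$ ("black", wire $k\in\mathbb N$ is 1) or $\mathrm{W}_K$ ("white", $K\subset\mathbb N$ finite, wires outside $K$ are 0), with $\mathrm W_K\le\mathrm W_L\iff L\subseteq K$, $\mathrm W_K\le\mathrm B_k\iff k\in K$, $\mathrm B_k\le\mathrm B_l\iff k=l$, and never $\mathrm B_k\le \mathrm W_K$. A *microstate* is a statement each node of which carries a boolean Sel, an input color and an output color; $p\le q$ means: same statement and Sel values, and all colors of $p$ are $\le$ those of $q$. For a microstate $p$ write $in(p),out(p),Go(p),Res(p),Susp(p),Sel(p)$ for its root annotation. $p$ is *gores* if $Go=+$ or ($Sel=+$ and $Res=+$); it is *nogores* if $Go=-$ and ($Sel=-$ or $Res=-$). *Operations on output colors.* $\downarrow,\uparrow$ act on codes: $\downarrow0=\downarrow2=0$, $\downarrow1=1$, $\downarrow k=k-1$ for $k>2$; $\uparrow k=k$ for $k\le1$, $\uparrow k=k+1$ for $k\ge2$. $\mathrm W_K\cup\mathrm W_L=\mathrm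 W_{K\cup L}$, $\mathrm B_k\cup\mathrm W_L=\mathrm W_L\cup\mathrm B_k=\mathrm B_k$, $\mathrm B_k\cup\mathrm B_l=\mathrm B_{\max(k,l)}$ (only met for $k=l$). $\mathrm W_K\setminus0=\mathrm W_{K\setminus\{0\}}$, $\mathrm B_0\setminus0=\mathrm W_\emptyset$, $\mathrm B_k\setminus0=\mathrm B_k$ for $k\ne0$. $\mathrm{SuspNow}(-,o)=o$; $\mathrm{SuspNow}(+,\mathrm B_k)=\mathrm B_{\max(1,k)}$, $\mathrm{SuspNow}(+,\mathrm W_\emptyset)=\mathrm B_1$, $\mathrm{SuspNow}(+,\mathrm W_K)=\mathrm W_{\{1\}\cup K\setminus\{0\}}$ for $K\neq\emptyset$; $\mathrm{SuspNow}(\bot,\mathrm B_0)=\mathrm W_{\{0,1\}}$ and $\mathrm{SuspNow}(\bot,o)=\mathrm W_{\{1\}}\cup o$ otherwise. With $\mathrm{Max}(K,L)=\{\max(k,l):k\in K,l\in L\}$, the synchronizer $\mathrm{syn}(\sigma,\tau,o,o')$ is: $\mathrm B_{\max(k,l)}$ for $(\mathrm B_k,\mathrm B_l)$; $\mathrm W_{K\cup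 L\cup \mathrm{Max}(K,L)}$ for $(\mathrm W_K,\mathrm W_L)$; and for $(\mathrm B_k,\mathrm W_L)$ or $(\mathrm W_L,\mathrm B_k)$ it is $\mathrm B_k$ if $L=\emptyset$ or $\sigma\ne\tau$, else $\mathrm W_{\{k\}\cup\mathrm{Max}(\{k\},L)}$. *Static codes* $c(p)$: $\{0\}$ for $\mathsf{nothing},!s$; $\{n+2\}$ for $\mathsf{exit}\,n$; $\{0,1\}$ for $\mathsf{pause},\mathsf{await}\,s$; $\downarrow c(p)$ for $\{p\}$; $\uparrow c(p)$ for $\uparrow p$; $\{1\}\cup c(p)$ for $\mathsf{susp}\,s\,p$; $c(p)\cup c(q)$ for $s?p,q$; $(c(p)\setminus\{0\})\cup c(q)$ for $p;q$; $c(p)\cup c(q)\cup\mathrm{Max}(c(p),c(q))$ for $p\,|\,q$; $c(p)$ for $p\backslash s$. `from_cmd`, `from_state` (jointly `from_term`) give each node the input color $(\bot,\bot,\bot)$ and the output color $\mathrm W_{c}$ with $c$ its static codes; Sel is $-$ everywhere for statements, and $+$ exactly on the active nodes (those that are states) for states. `back_to_term` turns a microstate into the term with the same statement whose marked $\mathsf{pause}$/$\mathsf{await}$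 nodes are those with $Sel=+$ (an arbitrary inert value if both parts of a test or of a sequence would be active). *Signal status.* $\mathrm{em}(s,p)$ is $+$ if some $!s$ in $p$ (not below a redeclaration of $s$) has output $\mathrm B_0$, $-$ if all of them have output $\mathrm W_\emptyset$, and $\bot$ otherwise. *Wires.* In a compound node with input color $(G,R,U)$ under $E$, the source values of the input colors of the parts are: - $\{p\}$, $\uparrow p$, $p\backslash s$, both parts of $p\,|\,q$, first part of $p;q$: $(G,R,U)$; - $\mathsf{susp}\,s\,p$: $(G,\ R\wedge Sel(p)\wedge\neg E(s),\ u)$ with $u:=U\vee(R\wedge Sel(p)\wedge E(s))$; - $s?p,q$: $(G\wedge E(s),R,U)$ for $p$ and $(G\wedge\neg E(s),R,U)$ for $q$; - second part of $p;q$: $(g,R,U)$ with $g=+$ if $out(p)=\mathrm B_0$, $g=-$ if $out(p)\not\le\mathrm B_0$, $g=\bot$ otherwise. The source values of the output colors are: $\downarrow out(p)$; $\uparrow out(p)$; $out(p)$ for $p\backslash s$; $\mathrm{SuspNow}(u,out(p))$; $out(p)\cup out(q)$ for $s?p,q$; $(out(p)\setminus0)\cup out(q)$ for $p;q$; $\mathrm{syn}(Sel(p),Sel(q),out(p),out(q))$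 for $p\,|\,q$. *Microsteps* $E\vdash p\to p'$. Compound nodes: (start) an input wire of a part (for $\{p\},\uparrow p,p\backslash s$, $p\,|\,q$ and the first part of $p;q$: the whole input color at once) is replaced by its source value if this is strictly larger; (context) a part makes a microstep, under $E$, or under $s^{\mathrm{em}(s,p)}*E$ for the body of $p\backslash s$; (end) the output color is replaced by its source value if this is strictly larger; for $\mathsf{susp}\,s\,p$ the same is possible with $\mathrm{SuspNow}(\bot,out(p))$. Atomic nodes: $\mathsf{nothing}$, $!s$ (with $k=0$) and $\mathsf{exit}\,n$ (with $k=n+2$), if $Sel=-$ and the output is $\mathrm W_{\{k\}}$, change it to $\mathrm W_\emptyset$ if $Go=-$ and to $\mathrm B_k$ if $Go=+$. For $\mathsf{pause}$: $\mathrm W_K\to\mathrm W_{K\setminus\{0\}}$ if $0\in K$ and ($Res=-$ or $Sel=-$); $\mathrm W_K\to\mathrm W_{K\setminus\{1\}}$ if $1\in K$ and $Go=-$; $o\to\mathrm B_1$ if $o<\mathrm B_1$, $Go=+$; $o\to\mathrm B_0$ if $o<\mathrm B_0$, $Sel=+,Res=+,Susp=-$. For $\mathsf{await}\,s$: $\mathrm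 W_K\to\mathrm W_{K\setminus\{0\}}$ if $0\in K$ and (nogores or $E(s)=-$); $\mathrm W_K\to\mathrm W_{K\setminus\{1\}}$ if $1\in K$ and (nogores or $E(s)=+$); if gores, $o\to\mathrm B_1$ if $o<\mathrm B_1$, $E(s)=-$, and $o\to\mathrm B_0$ if $o<\mathrm B_0$, $E(s)=+$. *The invariant.* $\mathrm{VC}\,E\,p$ means that $Susp(p)\neq+$ and that the following holds at every node of $p$ (where $E$ is replaced by $s^{\mathrm{em}(s,q)}*E$ inside the body $q$ of a declaration $q\backslash s$): 1. not ($Sel=+$ and $Go=+$); if $Susp=+$ then $Go\ne+$ and $Res\neq+$; 2. $Sel=-$ on $\mathsf{nothing}$, $\mathsf{exit}$, $!s$; on a compound node, $Sel$ is the disjunction of the Sel values of its parts, and the two parts of a test or a sequence do not both have $Sel=+$; 3. the signal read or emitted at the node ($!s$, $\mathsf{await}\,s$, $\mathsf{susp}\,s\,p$, $s?p,q$) is in $\mathrm{dom}(E)$; 4. on a compound node, the input color of each part is $\le$ its source value; 5. the output color $o$ satisfies $\mathrm W_{c}\le o\le o^*$, with $c$ the static codes of the node and $o^*$ the source value on a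 compound node. On atomic nodes: for $\mathsf{nothing}$, $\mathsf{exit}\,n$, $!s$ (code $k$), $o^*=\mathrm W_{\{k\}},\mathrm B_k,\mathrm W_\emptyset$ for $Go=\bot,+,-$. For $\mathsf{pause}$, $o^*=\mathrm B_1$ if $Go=+$; else $\mathrm B_0$ if $Sel=+,Res=+,Susp=-$; else $\mathrm W_K$, where $0\in K$ iff neither $Res=-$ nor $Sel=-$, and $1\in K$ iff $Go\ne-$ (and $K\subseteq\{0,1\}$). For $\mathsf{await}\,s$, $o^*=\mathrm B_0$ if gores and $E(s)=+$; $\mathrm B_1$ if gores and $E(s)=-$; $\mathrm W_\emptyset$ if nogores; else $\mathrm W_K$, where $K\subseteq\{0,1\}$, $0\in K$ iff $E(s)\ne-$, $1\in K$ iff $E(s)\neq+$. **Theorem (Invariant of the circuit translation).** 1. (Initial microstates.) If all free signals of a statement $p$ lie in $\mathrm{dom}(E)$, then $\mathrm{VC}\,E\,(\texttt{from\_cmd}\,p)$, also after replacing the root input color by any input color with $Susp\ne+$. If all free signals of $\mathrm{base}(\hat p)$, $\hat p$ a state, lie in $\mathrm{dom}(E)$, then $\mathrm{VC}\,E\,(\texttt{from\_state}\,\hat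 p)$, also after replacing the root input color by any input color with $Go\neq+$ and $Susp\neq+$. 2. (Preservation.) If $\mathrm{VC}\,E\,p$ and $E\vdash p\to p'$, then $\mathrm{VC}\,E\,p'$. 3. (Monotonicity in the signals.) If $\mathrm{dom}(E)=\mathrm{dom}(E')$, $E\le E'$ and $\mathrm{VC}\,E\,p$, then $\mathrm{VC}\,E'\,p$. 4. (Control is only propagated.) Let $\mathrm{VC}\,E\,p$. If $out(p)=\mathrm B_k$ for some $k$, then $p$ is gores. If $out(p)=\mathrm W_\emptyset$, then $p$ is nogores. 5. (Branches are not simultaneously active.) If $\mathrm{VC}\,E$ holds for a microstate of the form $s?p,q$, then $p$ is not gores or $q$ is not gores. If it holds for a microstate of the form $p;q$, then $out(p)\setminus0$ is not black or $out(q)$ is not black; moreover, $out(p)\setminus0$ is not black or $q$ is not gores. 6. (Comparison with starting microstates.) If $\mathrm{VC}\,E\,p$, then $\texttt{from\_term}(\texttt{back\_to\_term}(p))\le p$. -/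

import Mathlib

namespace Esterel

/-! ### Scott booleans, input colors, output colors -/

/-- Scott booleans: unknown, true, false. -/
inductive Scott where
  | bot | pos | neg
  deriving DecidableEq

namespace Scott

/-- Flat information order: `bot` is below everything. -/
instance : PartialOrder Scott where
  le a b := a = bot ∨ a = b
  le_refl _ := Or.inr rfl
  le_trans a b c h₁ h₂ := by
    rcases h₁ with h | h
    · exact Or.inl h
    · subst h; exact h₂
  le_antisymm a b h₁ h₂ := by
    rcases h₁ with h | h
    · rcases h₂ with h' | h'
      · rw [h, h']
      · exact h'.symm
    · exact h

def ofBool : Bool → Scott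
  | true => pos
  | false => neg

def not : Scott → Scott
  | bot => bot
  | pos => neg
  | neg => pos

/-- Parallel (Kleene) conjunction: an AND gate. -/
def and : Scott → Scott → Scott
  | neg, _ => neg
  | _, neg => neg
  | pos, pos => pos
  | _, _ => bot

/-- Parallel (Kleene) disjunction: an OR gate. -/
def or : Scott → Scott → Scott
  | pos, _ => pos
  | _, pos => pos
  | neg, neg => neg
  | _, _ => bot

end Scott

/-- Input colors: the Go, Res and Susp wires. -/
@[ext]
structure InColor where
  go : Scott
  res : Scott
  susp : Scott
  deriving DecidableEq

/-- Componentwise information order on input colors. -/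
instance : PartialOrder InColor where
  le i j := i.go ≤ j.go ∧ i.res ≤ j.res ∧ i.susp ≤ j.susp
  le_refl _ := ⟨le_refl _, le_refl _, le_refl _⟩
  le_trans _ _ _ h₁ h₂ :=
    ⟨h₁.1.trans h₂.1, h₁.2.1.trans h₂.2.1, h₁.2.2.trans h₂.2.2⟩
  le_antisymm _ _ h₁ h₂ :=
    InColor.ext (le_antisymm h₁.1 h₂.1) (le_antisymm h₁.2.1 h₂.2.1)
      (le_antisymm h₁.2.2 h₂.2.2)

/-- The input color without any information. -/
def InColor.unknown : InColor := ⟨.bot, .bot, .bot⟩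

/-- Output colors. `black k`: return code wire `k` is 1 (all others are 0).
`white K`: the wires outside `K` are 0, those of `K` are still unknown. -/
inductive OutColor where
  | black (k : ℕ)
  | white (K : Finset ℕ)
  deriving DecidableEq

namespace OutColor

/-- Information order on output colors. -/
def Le : OutColor → OutColor → Prop
  | white K, white L => L ⊆ K
  | white K, black k => k ∈ K
  | black k, black l => k = l
  | black _, white _ => False

instance : PartialOrder OutColor where
  le := Le
  le_refl a := by cases a <;> simp [Le]
  le_trans a b c h₁ h₂ := by
    cases a <;> cases b <;> cases c <;> simp_all [Le]
    · exact h₁ h₂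
    · exact h₂.trans h₁
  le_antisymm a b h₁ h₂ := by
    cases a <;> cases b <;> simp_all [Le]
    exact Finset.Subset.antisymm h₂ h₁

def IsBlack (o : OutColor) : Prop := ∃ k, o = black k

/-- Apply a relabelling of return codes. -/
def map (f : ℕ → ℕ) : OutColor → OutColor
  | black k => black (f k)
  | white K => white (K.image f)

/-- Union of output colors (one OR gate per return code wire). Two different black
colors never meet in well-colored microstates; the value there is a convention. -/
def union : OutColor → OutColor → OutColor
  | black k, black l => black (max k l)
  | black k, white _ => black k
  | white _, black l => black l
  | white K, white L => white (K ∪ L)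

/-- Cut the return code wire 0. -/
def minusZero : OutColor → OutColor
  | black 0 => white ∅
  | black k => black k
  | white K => white (K \ {0})

/-- Return code of a suspension, where the Scott boolean tells whether the
suspension takes place in the current instant. -/
def suspNow : Scott → OutColor → OutColor
  | .neg, o => o
  | .pos, black k => black (max 1 k)
  | .pos, white K => if K = ∅ then black 1 else white ({1} ∪ K \ {0})
  | .bot, o => if o = black 0 then white {0, 1} else union (white {1}) o

end OutColor

open OutColor

/-- All maxima of a code of `K` and a code of `L`. -/
def maxCodes (K L : Finset ℕ) : Finset ℕ := (K ×ˢ L).image fun x => max x.1 x.2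

/-- The synchronizer of the parallel statement: the maximum of the return codes of
both branches, where a dead branch (`white ∅`) is neutral. The possible codes in
presence of incomplete information take into account that a branch which is not
black yet may turn out to be dead; a branch which is not selected while the other one is
selected cannot be executed. -/
def synchronize (sp sq : Bool) : OutColor → OutColor → OutColor
  | black k, black l => black (max k l)
  | black k, white L =>
      if L = ∅ ∨ sp ≠ sq then black k else white ({k} ∪ maxCodes {k} L)
  | white K, black l =>
      if K = ∅ ∨ sp ≠ sq then black l else white ({l} ∪ maxCodes K {l})
  | white K, white L => white (K ∪ L ∪ maxCodes K L)

/-- Effect of a trap on return codes. -/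
def downCode (k : ℕ) : ℕ := if k = 2 then 0 else if 2 < k then k - 1 else k

/-- Effect of a shift on return codes. -/
def upCode (k : ℕ) : ℕ := if 2 ≤ k then k + 1 else k

/-- The annotation of a microstate: Sel boolean, input color, output color. -/
structure Colors where
  sel : Bool
  inp : InColor
  out : OutColor

/-- The statement is executed: started, or selected and resumed. -/
def Colors.GoRes (c : Colors) : Prop :=
  c.inp.go = .pos ∨ (c.sel = true ∧ c.inp.res = .pos)

/-- The statement is not executed. -/
def Colors.NoGoRes (c : Colors) : Prop :=
  c.inp.go = .neg ∧ (c.sel = false ∨ c.inp.res = .neg)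

/-! ### Events -/

/-- Constructive events: partial maps from signals to statuses. -/
def Event (S : Type*) := S → Option Scott

namespace Event

variable {S : Type*}

/-- The set of signals in scope. -/
def dom (E : Event S) : Set S := {s | (E s).isSome}

/-- The status of a signal, unknown if the signal is not in scope. -/
def val (E : Event S) (s : S) : Scott := (E s).getD .bot

/-- `s^b * E`: declare `s` with status `b`, hiding a previous declaration. -/
def add [DecidableEq S] (s : S) (b : Scott) (E : Event S) : Event S :=
  fun t => if t = s then some b else E t

/-- Pointwise information order. -/
instance : LE (Event S) where
  le E E' := ∀ s, E.val s ≤ E'.val s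

end Event

/-! ### Commands, states and terms (loop-free Kernel Esterel) -/

/-- Statements; the microstep semantics does not cover loops. `exit n` returns the completion code `n + 2`. -/
inductive Cmd (S : Type*) where
  | nothing
  | pause
  | exit (n : ℕ)
  | emit (s : S)
  | awaitImm (s : S)
  | trap (p : Cmd S)
  | shift (p : Cmd S)
  | suspend (s : S) (p : Cmd S)
  | test (s : S) (p q : Cmd S)
  | seq (p q : Cmd S)
  | par (p q : Cmd S)
  | signal (s : S) (p : Cmd S)

/-- States: statements with marks at the `pause` and `awaitImm` statements where
execution resumes; `testL`, `testR`, … tell which branches are active. -/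
inductive AState (S : Type*) where
  | pause
  | awaitImm (s : S)
  | trap (p : AState S)
  | shift (p : AState S)
  | suspend (s : S) (p : AState S)
  | testL (s : S) (p : AState S) (q : Cmd S)
  | testR (s : S) (p : Cmd S) (q : AState S)
  | seqL (p : AState S) (q : Cmd S)
  | seqR (p : Cmd S) (q : AState S)
  | parL (p : AState S) (q : Cmd S)
  | parR (p : Cmd S) (q : AState S)
  | parB (p q : AState S)
  | signal (s : S) (p : AState S)

/-- Terms: inert statements or active states. -/
inductive Term (S : Type*) where
  | cmd (p : Cmd S)
  | state (p : AState S)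

section Terms

variable {S : Type*}

/-- The set of signals used in a statement and not declared in it. -/
def Cmd.free : Cmd S → Set S
  | .nothing => ∅
  | .pause => ∅
  | .exit _ => ∅
  | .emit s => {s}
  | .awaitImm s => {s}
  | .trap p => p.free
  | .shift p => p.free
  | .suspend s p => {s} ∪ p.free
  | .test s p q => {s} ∪ p.free ∪ q.free
  | .seq p q => p.free ∪ q.free
  | .par p q => p.free ∪ q.free
  | .signal s p => p.free \ {s}

/-- The statically possible return codes. -/
def Cmd.codes : Cmd S → Finset ℕ
  | .nothing => {0}
  | .pause => {0, 1}
  | .exit n => {n + 2}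
  | .emit _ => {0}
  | .awaitImm _ => {0, 1}
  | .trap p => p.codes.image downCode
  | .shift p => p.codes.image upCode
  | .suspend _ p => {1} ∪ p.codes
  | .test _ p q => p.codes ∪ q.codes
  | .seq p q => (p.codes \ {0}) ∪ q.codes
  | .par p q => p.codes ∪ q.codes ∪ maxCodes p.codes q.codes
  | .signal _ p => p.codes

/-- The underlying statement of a state. -/
def AState.base : AState S → Cmd S
  | .pause => .pause
  | .awaitImm s => .awaitImm s
  | .trap p => .trap p.base
  | .shift p => .shift p.base
  | .suspend s p => .suspend s p.base
  | .testL s p q => .test s p.base q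
  | .testR s p q => .test s p q.base
  | .seqL p q => .seq p.base q
  | .seqR p q => .seq p q.base
  | .parL p q => .par p.base q
  | .parR p q => .par p q.base
  | .parB p q => .par p.base q.base
  | .signal s p => .signal s p.base

end Terms

/-! ### Microstates -/

/-- Microstates: statements in which every node carries a Sel boolean, an input color
and an output color. -/
inductive MState (S : Type*) where
  | nothing (c : Colors)
  | pause (c : Colors)
  | exit (c : Colors) (n : ℕ)
  | emit (c : Colors) (s : S)
  | awaitImm (c : Colors) (s : S)
  | trap (c : Colors) (p : MState S)
  | shift (c : Colors) (p : MState S)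
  | suspend (c : Colors) (s : S) (p : MState S)
  | test (c : Colors) (s : S) (p q : MState S)
  | seq (c : Colors) (p q : MState S)
  | par (c : Colors) (p q : MState S)
  | signal (c : Colors) (s : S) (p : MState S)

namespace MState

variable {S : Type*}

/-- The colors of the root of a microstate. -/
def colors : MState S → Colors
  | nothing c => c
  | pause c => c
  | exit c _ => c
  | emit c _ => c
  | awaitImm c _ => c
  | trap c _ => c
  | shift c _ => c
  | suspend c _ _ => c
  | test c _ _ _ => c
  | seq c _ _ => c
  | par c _ _ => c
  | signal c _ _ => c

def setColors (d : Colors) : MState S → MState S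
  | nothing _ => nothing d
  | pause _ => pause d
  | exit _ n => exit d n
  | emit _ s => emit d s
  | awaitImm _ s => awaitImm d s
  | trap _ p => trap d p
  | shift _ p => shift d p
  | suspend _ s p => suspend d s p
  | test _ s p q => test d s p q
  | seq _ p q => seq d p q
  | par _ p q => par d p q
  | signal _ s p => signal d s p

def sel (p : MState S) : Bool := p.colors.sel
def inC (p : MState S) : InColor := p.colors.inp
def outC (p : MState S) : OutColor := p.colors.out

/-- Change the input color of the root. -/
def setIn (i : InColor) (p : MState S) : MState S :=
  p.setColors { p.colors with inp := i }
def setGo (b : Scott) (p : MState S) : MState S := p.setIn { p.inC with go := b }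
def setRes (b : Scott) (p : MState S) : MState S := p.setIn { p.inC with res := b }
def setSusp (b : Scott) (p : MState S) : MState S := p.setIn { p.inC with susp := b }

/-- The underlying statement of a microstate. -/
def base : MState S → Cmd S
  | nothing _ => .nothing
  | pause _ => .pause
  | exit _ n => .exit n
  | emit _ s => .emit s
  | awaitImm _ s => .awaitImm s
  | trap _ p => .trap p.base
  | shift _ p => .shift p.base
  | suspend _ s p => .suspend s p.base
  | test _ s p q => .test s p.base q.base
  | seq _ p q => .seq p.base q.base
  | par _ p q => .par p.base q.base
  | signal _ s p => .signal s p.base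

/-- The statically possible return codes. -/
def codes (p : MState S) : Finset ℕ := p.base.codes

/-- The information order on colors; Sel values have to agree. -/
def _root_.Esterel.Colors.Le (c d : Colors) : Prop :=
  c.sel = d.sel ∧ c.inp ≤ d.inp ∧ c.out ≤ d.out

/-- The information order on microstates. -/
inductive Le : MState S → MState S → Prop
  | nothing {c d} : c.Le d → Le (nothing c) (nothing d)
  | pause {c d} : c.Le d → Le (pause c) (pause d)
  | exit {c d n} : c.Le d → Le (exit c n) (exit d n)
  | emit {c d s} : c.Le d → Le (emit c s) (emit d s)
  | awaitImm {c d s} : c.Le d → Le (awaitImm c s) (awaitImm d s)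
  | trap {c d p p'} : c.Le d → Le p p' → Le (trap c p) (trap d p')
  | shift {c d p p'} : c.Le d → Le p p' → Le (shift c p) (shift d p')
  | suspend {c d s p p'} : c.Le d → Le p p' → Le (suspend c s p) (suspend d s p')
  | test {c d s p p' q q'} : c.Le d → Le p p' → Le q q' →
      Le (test c s p q) (test d s p' q')
  | seq {c d p p' q q'} : c.Le d → Le p p' → Le q q' → Le (seq c p q) (seq d p' q')
  | par {c d p p' q q'} : c.Le d → Le p p' → Le q q' → Le (par c p q) (par d p' q')
  | signal {c d s p p'} : c.Le d → Le p p' → Le (signal c s p) (signal d s p')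

instance : LE (MState S) := ⟨Le⟩

/-- The status of the signal `s` that can be read off from the emitters of `s`:
present if some emitter has color `black 0`, absent if all of them have color
`white ∅`, unknown otherwise. Emitters below a redeclaration of `s` do not count. -/
def emitted [DecidableEq S] (s : S) : MState S → Scott
  | nothing _ => .neg
  | pause _ => .neg
  | exit _ _ => .neg
  | emit c t =>
      if t = s then
        if c.out = black 0 then .pos else if c.out = white ∅ then .neg else .bot
      else .neg
  | awaitImm _ _ => .neg
  | trap _ p => p.emitted s
  | shift _ p => p.emitted s
  | suspend _ _ p => p.emitted s
  | test _ _ p q => (p.emitted s).or (q.emitted s)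
  | seq _ p q => (p.emitted s).or (q.emitted s)
  | par _ p q => (p.emitted s).or (q.emitted s)
  | signal _ t p => if t = s then .neg else p.emitted s

/-- The output event of a microstate, on the signals of `E`. -/
def toEvent [DecidableEq S] (p : MState S) (E : Event S) : Event S :=
  fun s => (E s).map fun _ => p.emitted s

/-- The status of the local signal `s` inside `signal s p`. -/
def localStatus [DecidableEq S] (s : S) (p : MState S) (E : Event S) : Scott :=
  (p.toEvent (E.add s .bot)).val s

end MState

/-! ### Conversions between terms and microstates -/

section Conversions

variable {S : Type*}

/-- Colors of an initial microstate. -/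
def initColors (sel : Bool) (K : Finset ℕ) : Colors := ⟨sel, .unknown, white K⟩

/-- The initial microstate of an inert statement: nothing is selected. -/
def fromCmd : Cmd S → MState S
  | .nothing => .nothing (initColors false (Cmd.nothing : Cmd S).codes)
  | .pause => .pause (initColors false (Cmd.pause : Cmd S).codes)
  | .exit n => .exit (initColors false (Cmd.exit n : Cmd S).codes) n
  | .emit s => .emit (initColors false (Cmd.emit s).codes) s
  | .awaitImm s => .awaitImm (initColors false (Cmd.awaitImm s).codes) s
  | .trap p => .trap (initColors false p.trap.codes) (fromCmd p)
  | .shift p => .shift (initColors false p.shift.codes) (fromCmd p)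
  | .suspend s p => .suspend (initColors false (p.suspend s).codes) s (fromCmd p)
  | .test s p q =>
      .test (initColors false (Cmd.test s p q).codes) s (fromCmd p) (fromCmd q)
  | .seq p q => .seq (initColors false (p.seq q).codes) (fromCmd p) (fromCmd q)
  | .par p q => .par (initColors false (p.par q).codes) (fromCmd p) (fromCmd q)
  | .signal s p => .signal (initColors false (p.signal s).codes) s (fromCmd p)

/-- The initial microstate of a state: the active parts are selected. -/
def fromState : AState S → MState S
  | .pause => .pause (initColors true (Cmd.pause : Cmd S).codes)
  | .awaitImm s => .awaitImm (initColors true (Cmd.awaitImm s).codes) s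
  | .trap p => .trap (initColors true p.trap.base.codes) (fromState p)
  | .shift p => .shift (initColors true p.shift.base.codes) (fromState p)
  | .suspend s p => .suspend (initColors true (p.suspend s).base.codes) s (fromState p)
  | .testL s p q =>
      .test (initColors true (AState.testL s p q).base.codes) s (fromState p) (fromCmd q)
  | .testR s p q =>
      .test (initColors true (AState.testR s p q).base.codes) s (fromCmd p) (fromState q)
  | .seqL p q => .seq (initColors true (p.seqL q).base.codes) (fromState p) (fromCmd q)
  | .seqR p q =>
      .seq (initColors true (AState.seqR p q).base.codes) (fromCmd p) (fromState q)
  | .parL p q => .par (initColors true (p.parL q).base.codes) (fromState p) (fromCmd q)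
  | .parR p q =>
      .par (initColors true (AState.parR p q).base.codes) (fromCmd p) (fromState q)
  | .parB p q =>
      .par (initColors true (p.parB q).base.codes) (fromState p) (fromState q)
  | .signal s p => .signal (initColors true (p.signal s).base.codes) s (fromState p)

def fromTerm : Term S → MState S
  | .cmd p => fromCmd p
  | .state p => fromState p

/-- The term from which the current instant was started, as recorded by the Sel values of
the `pause` and `awaitImm` nodes. The two cases with simultaneously selected branches of a
test or a sequence do not correspond to any term and get an inert value. -/
def backToTerm : MState S → Term S
  | .nothing _ => .cmd .nothing
  | .pause c => if c.sel then .state .pause else .cmd .pause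
  | .exit _ n => .cmd (.exit n)
  | .emit _ s => .cmd (.emit s)
  | .awaitImm c s => if c.sel then .state (.awaitImm s) else .cmd (.awaitImm s)
  | .trap _ p =>
      match backToTerm p with
      | .cmd p => .cmd (.trap p)
      | .state p => .state (.trap p)
  | .shift _ p =>
      match backToTerm p with
      | .cmd p => .cmd (.shift p)
      | .state p => .state (.shift p)
  | .suspend _ s p =>
      match backToTerm p with
      | .cmd p => .cmd (.suspend s p)
      | .state p => .state (.suspend s p)
  | .test _ s p q =>
      match backToTerm p, backToTerm q with
      | .cmd p, .cmd q => .cmd (.test s p q)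
      | .state p, .cmd q => .state (.testL s p q)
      | .cmd p, .state q => .state (.testR s p q)
      | .state p, .state q => .cmd (.test s p.base q.base)
  | .seq _ p q =>
      match backToTerm p, backToTerm q with
      | .cmd p, .cmd q => .cmd (.seq p q)
      | .state p, .cmd q => .state (.seqL p q)
      | .cmd p, .state q => .state (.seqR p q)
      | .state p, .state q => .cmd (.seq p.base q.base)
  | .par _ p q =>
      match backToTerm p, backToTerm q with
      | .cmd p, .cmd q => .cmd (.par p q)
      | .state p, .cmd q => .state (.parL p q)
      | .cmd p, .state q => .state (.parR p q)
      | .state p, .state q => .state (.parB p q)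
  | .signal _ s p =>
      match backToTerm p with
      | .cmd p => .cmd (.signal s p)
      | .state p => .state (.signal s p)

end Conversions

/-! ### The microstep semantics -/

section Semantics

variable {S : Type*}

/-! For every compound statement there are start rules (input colors of the parts), context
rules (microsteps of the parts) and end rules (output color of the whole). -/

/-- Res wire of the body of `suspend s p`, where `c` are the colors of the whole. -/
def suspendRes (E : Event S) (c : Colors) (s : S) (p : MState S) : Scott :=
  (c.inp.res.and (.ofBool p.sel)).and (E.val s).not

/-- Susp wire of the body of `suspend s p`, where `c` are the colors of the whole. -/
def suspendSusp (E : Event S) (c : Colors) (s : S) (p : MState S) : Scott :=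
  c.inp.susp.or ((c.inp.res.and (.ofBool p.sel)).and (E.val s))

/-- `Step E p p'`: the microstate `p` reduces to `p'` in one microstep under `E`. -/
inductive Step [DecidableEq S] : Event S → MState S → MState S → Prop
  -- nothing, exit, emit
  | nothing_nogo {E c} : c.sel = false → c.inp.go = .neg → c.out = white {0} →
      Step E (.nothing c) (.nothing { c with out := white ∅ })
  | nothing_go {E c} : c.sel = false → c.inp.go = .pos → c.out = white {0} →
      Step E (.nothing c) (.nothing { c with out := black 0 })
  | exit_nogo {E c n} : c.sel = false → c.inp.go = .neg → c.out = white {n + 2} →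
      Step E (.exit c n) (.exit { c with out := white ∅ } n)
  | exit_go {E c n} : c.sel = false → c.inp.go = .pos → c.out = white {n + 2} →
      Step E (.exit c n) (.exit { c with out := black (n + 2) } n)
  | emit_nogo {E c s} : c.sel = false → c.inp.go = .neg → c.out = white {0} →
      Step E (.emit c s) (.emit { c with out := white ∅ } s)
  | emit_go {E c s} : c.sel = false → c.inp.go = .pos → c.out = white {0} →
      Step E (.emit c s) (.emit { c with out := black 0 } s)
  -- pause
  | pause_not0 {E c K} : c.inp.res = .neg ∨ c.sel = false → c.out = white K → 0 ∈ K →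
      Step E (.pause c) (.pause { c with out := white (K \ {0}) })
  | pause_not1 {E c K} : c.inp.go = .neg → c.out = white K → 1 ∈ K →
      Step E (.pause c) (.pause { c with out := white (K \ {1}) })
  | pause_go {E c} : c.inp.go = .pos → c.out < black 1 →
      Step E (.pause c) (.pause { c with out := black 1 })
  | pause_res {E c} : c.sel = true → c.inp.res = .pos → c.inp.susp = .neg →
      c.out < black 0 →
      Step E (.pause c) (.pause { c with out := black 0 })
  -- await immediate
  | await_not0 {E c s K} : c.NoGoRes ∨ E.val s = .neg → c.out = white K → 0 ∈ K →
      Step E (.awaitImm c s) (.awaitImm { c with out := white (K \ {0}) } s)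
  | await_not1 {E c s K} : c.NoGoRes ∨ E.val s = .pos → c.out = white K → 1 ∈ K →
      Step E (.awaitImm c s) (.awaitImm { c with out := white (K \ {1}) } s)
  | await_wait {E c s} : c.GoRes → E.val s = .neg → c.out < black 1 →
      Step E (.awaitImm c s) (.awaitImm { c with out := black 1 } s)
  | await_done {E c s} : c.GoRes → E.val s = .pos → c.out < black 0 →
      Step E (.awaitImm c s) (.awaitImm { c with out := black 0 } s)
  -- trap
  | trap_start {E c p} : p.inC < c.inp → Step E (.trap c p) (.trap c (p.setIn c.inp))
  | trap_ctx {E c p p'} : Step E p p' → Step E (.trap c p) (.trap c p')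
  | trap_end {E c p} : c.out < p.outC.map downCode →
      Step E (.trap c p) (.trap { c with out := p.outC.map downCode } p)
  -- shift
  | shift_start {E c p} : p.inC < c.inp → Step E (.shift c p) (.shift c (p.setIn c.inp))
  | shift_ctx {E c p p'} : Step E p p' → Step E (.shift c p) (.shift c p')
  | shift_end {E c p} : c.out < p.outC.map upCode →
      Step E (.shift c p) (.shift { c with out := p.outC.map upCode } p)
  -- suspend
  | suspend_go {E c s p} : p.inC.go < c.inp.go →
      Step E (.suspend c s p) (.suspend c s (p.setGo c.inp.go))
  | suspend_res {E c s p} : p.inC.res < suspendRes E c s p →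
      Step E (.suspend c s p) (.suspend c s (p.setRes (suspendRes E c s p)))
  | suspend_susp {E c s p} : p.inC.susp < suspendSusp E c s p →
      Step E (.suspend c s p) (.suspend c s (p.setSusp (suspendSusp E c s p)))
  | suspend_ctx {E c s p p'} : Step E p p' → Step E (.suspend c s p) (.suspend c s p')
  | suspend_end_unknown {E c s p} : c.out < suspNow .bot p.outC →
      Step E (.suspend c s p) (.suspend { c with out := suspNow .bot p.outC } s p)
  | suspend_end {E c s p} : c.out < suspNow (suspendSusp E c s p) p.outC →
      Step E (.suspend c s p)
        (.suspend { c with out := suspNow (suspendSusp E c s p) p.outC } s p)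
  -- test
  | test_goL {E c s p q} : p.inC.go < c.inp.go.and (E.val s) →
      Step E (.test c s p q) (.test c s (p.setGo (c.inp.go.and (E.val s))) q)
  | test_goR {E c s p q} : q.inC.go < c.inp.go.and (E.val s).not →
      Step E (.test c s p q) (.test c s p (q.setGo (c.inp.go.and (E.val s).not)))
  | test_resL {E c s p q} : p.inC.res < c.inp.res →
      Step E (.test c s p q) (.test c s (p.setRes c.inp.res) q)
  | test_resR {E c s p q} : q.inC.res < c.inp.res →
      Step E (.test c s p q) (.test c s p (q.setRes c.inp.res))
  | test_suspL {E c s p q} : p.inC.susp < c.inp.susp →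
      Step E (.test c s p q) (.test c s (p.setSusp c.inp.susp) q)
  | test_suspR {E c s p q} : q.inC.susp < c.inp.susp →
      Step E (.test c s p q) (.test c s p (q.setSusp c.inp.susp))
  | test_ctxL {E c s p p' q} : Step E p p' → Step E (.test c s p q) (.test c s p' q)
  | test_ctxR {E c s p q q'} : Step E q q' → Step E (.test c s p q) (.test c s p q')
  | test_end {E c s p q} : c.out < p.outC.union q.outC →
      Step E (.test c s p q) (.test { c with out := p.outC.union q.outC } s p q)
  -- sequence
  | seq_startL {E c p q} : p.inC < c.inp → Step E (.seq c p q) (.seq c (p.setIn c.inp) q)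
  | seq_resR {E c p q} : q.inC.res < c.inp.res →
      Step E (.seq c p q) (.seq c p (q.setRes c.inp.res))
  | seq_suspR {E c p q} : q.inC.susp < c.inp.susp →
      Step E (.seq c p q) (.seq c p (q.setSusp c.inp.susp))
  | seq_goR {E c p q} : p.outC = black 0 → q.inC.go = .bot →
      Step E (.seq c p q) (.seq c p (q.setGo .pos))
  | seq_nogoR {E c p q} : ¬ p.outC ≤ black 0 → q.inC.go = .bot →
      Step E (.seq c p q) (.seq c p (q.setGo .neg))
  | seq_ctxL {E c p p' q} : Step E p p' → Step E (.seq c p q) (.seq c p' q)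
  | seq_ctxR {E c p q q'} : Step E q q' → Step E (.seq c p q) (.seq c p q')
  | seq_end {E c p q} : c.out < p.outC.minusZero.union q.outC →
      Step E (.seq c p q) (.seq { c with out := p.outC.minusZero.union q.outC } p q)
  -- parallel
  | par_startL {E c p q} : p.inC < c.inp → Step E (.par c p q) (.par c (p.setIn c.inp) q)
  | par_startR {E c p q} : q.inC < c.inp → Step E (.par c p q) (.par c p (q.setIn c.inp))
  | par_ctxL {E c p p' q} : Step E p p' → Step E (.par c p q) (.par c p' q)
  | par_ctxR {E c p q q'} : Step E q q' → Step E (.par c p q) (.par c p q')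
  | par_end {E c p q} : c.out < synchronize p.sel q.sel p.outC q.outC →
      Step E (.par c p q)
        (.par { c with out := synchronize p.sel q.sel p.outC q.outC } p q)
  -- signal declaration
  | signal_start {E c s p} : p.inC < c.inp →
      Step E (.signal c s p) (.signal c s (p.setIn c.inp))
  | signal_ctx {E c s p p'} : Step (E.add s (p.localStatus s E)) p p' →
      Step E (.signal c s p) (.signal c s p')
  | signal_end {E c s p} : c.out < p.outC →
      Step E (.signal c s p) (.signal { c with out := p.outC } s p)

end Semantics

/-! ### The invariant -/

section Invariant

variable {S : Type*}

/-- Input colors that occur in the translation: only inert statements are started, and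
a frozen statement is neither started nor resumed. -/
def Colors.Admissible (c : Colors) : Prop :=
  ¬ (c.sel = true ∧ c.inp.go = .pos) ∧
    (c.inp.susp = .pos → c.inp.go ≠ .pos ∧ c.inp.res ≠ .pos)

/-- Between the static return codes `K` and the output color `o` that is determined by
the information the node has access to. -/
def Colors.OutBetween (c : Colors) (K : Finset ℕ) (o : OutColor) : Prop :=
  white K ≤ c.out ∧ c.out ≤ o

/-- Output color determined for a statement that returns code `k` when started. -/
def leafOut (k : ℕ) : Scott → OutColor
  | .bot => white {k}
  | .pos => black k
  | .neg => white ∅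

open Classical in
/-- Output color determined for `pause`. -/
noncomputable def pauseOut (c : Colors) : OutColor :=
  if c.inp.go = .pos then black 1
  else if c.sel = true ∧ c.inp.res = .pos ∧ c.inp.susp = .neg then black 0
  else white ((if c.inp.res = .neg ∨ c.sel = false then ∅ else {0}) ∪
    (if c.inp.go = .neg then ∅ else {1}))

open Classical in
/-- Output color determined for `awaitImm`, where `b` is the status of the signal. -/
noncomputable def awaitOut (c : Colors) (b : Scott) : OutColor :=
  if c.GoRes ∧ b = .pos then black 0
  else if c.GoRes ∧ b = .neg then black 1
  else if c.NoGoRes then white ∅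
  else white ((if b = .neg then ∅ else {0}) ∪ (if b = .pos then ∅ else {1}))

/-- Go wire of the second part of a sequence, determined by the output of the first. -/
def seqGo : OutColor → Scott
  | black 0 => .pos
  | black _ => .neg
  | white K => if 0 ∈ K then .bot else .neg

/-- All colors inside the microstate are coherent: the Sel values are those of a term,
input colors carry at most the information provided by their sources, output colors
carry at least the static information and at most the one provided by their sources.
Moreover, all signals in use are declared. -/
def Coherent [DecidableEq S] : Event S → MState S → Prop
  | _, .nothing c =>
      c.Admissible ∧ c.sel = false ∧ c.OutBetween {0} (leafOut 0 c.inp.go)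
  | _, .pause c =>
      c.Admissible ∧ c.OutBetween {0, 1} (pauseOut c)
  | _, .exit c n =>
      c.Admissible ∧ c.sel = false ∧ c.OutBetween {n + 2} (leafOut (n + 2) c.inp.go)
  | E, .emit c s =>
      c.Admissible ∧ s ∈ E.dom ∧ c.sel = false ∧ c.OutBetween {0} (leafOut 0 c.inp.go)
  | E, .awaitImm c s =>
      c.Admissible ∧ s ∈ E.dom ∧ c.OutBetween {0, 1} (awaitOut c (E.val s))
  | E, .trap c p =>
      c.Admissible ∧ Coherent E p ∧ c.sel = p.sel ∧ p.inC ≤ c.inp ∧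
        c.OutBetween (p.codes.image downCode) (p.outC.map downCode)
  | E, .shift c p =>
      c.Admissible ∧ Coherent E p ∧ c.sel = p.sel ∧ p.inC ≤ c.inp ∧
        c.OutBetween (p.codes.image upCode) (p.outC.map upCode)
  | E, .suspend c s p =>
      c.Admissible ∧ s ∈ E.dom ∧ Coherent E p ∧ c.sel = p.sel ∧
        p.inC ≤ ⟨c.inp.go, suspendRes E c s p, suspendSusp E c s p⟩ ∧
        c.OutBetween ({1} ∪ p.codes) (suspNow (suspendSusp E c s p) p.outC)
  | E, .test c s p q =>
      c.Admissible ∧ s ∈ E.dom ∧ Coherent E p ∧ Coherent E q ∧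
        c.sel = (p.sel || q.sel) ∧ ¬ (p.sel = true ∧ q.sel = true) ∧
        p.inC ≤ ⟨c.inp.go.and (E.val s), c.inp.res, c.inp.susp⟩ ∧
        q.inC ≤ ⟨c.inp.go.and (E.val s).not, c.inp.res, c.inp.susp⟩ ∧
        c.OutBetween (p.codes ∪ q.codes) (p.outC.union q.outC)
  | E, .seq c p q =>
      c.Admissible ∧ Coherent E p ∧ Coherent E q ∧
        c.sel = (p.sel || q.sel) ∧ ¬ (p.sel = true ∧ q.sel = true) ∧
        p.inC ≤ c.inp ∧ q.inC ≤ ⟨seqGo p.outC, c.inp.res, c.inp.susp⟩ ∧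
        c.OutBetween ((p.codes \ {0}) ∪ q.codes) (p.outC.minusZero.union q.outC)
  | E, .par c p q =>
      c.Admissible ∧ Coherent E p ∧ Coherent E q ∧
        c.sel = (p.sel || q.sel) ∧ p.inC ≤ c.inp ∧ q.inC ≤ c.inp ∧
        c.OutBetween (p.codes ∪ q.codes ∪ maxCodes p.codes q.codes)
          (synchronize p.sel q.sel p.outC q.outC)
  | E, .signal c s p =>
      c.Admissible ∧ Coherent (E.add s (p.localStatus s E)) p ∧ c.sel = p.sel ∧
        p.inC ≤ c.inp ∧ c.OutBetween p.codes p.outC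

/-- The invariant: the colors are coherent and the microstate as a whole is not frozen
(a frozen `suspend` node returns code 1 even when it is not executed, so the link between
output and input colors can only be expected of microstates that are not frozen).
All sub-microstates that are not frozen satisfy the invariant, too. -/
def VC [DecidableEq S] (E : Event S) (p : MState S) : Prop :=
  Coherent E p ∧ p.inC.susp ≠ .pos

end Invariant

end Esterel

/-!
Control is never created in a coherent microstate: an output wire can be 1 only if the
statement is executed, that is, started, or selected and resumed. Since a selected statement
is never started, two statements that exclude each other (the branches of a test, the parts
of a sequence) are then never executed together, and this makes the gates that compute
output colors monotone where they are used: the union of output colors and the synchronizer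
respect the information order unless two different black colors meet. With monotone gates,
the invariant "every wire carries at most what its source provides" survives whenever some
wire takes over the value of its source.

The first claim fails for frozen statements, those with Susp = +, because a frozen `suspend`
returns 1 without being executed, and a statement that is not frozen may have frozen parts.
`Coherent.activeWith` therefore says for all coherent microstates that a black output
means execution, or frozenness and return code 1. This suffices: code 0 still certifies
execution, so that sequences propagate control correctly (`seq_admissible`), and two
frozen parts return the same code, so that no conflict arises (`Colors.ActiveWith.code_eq`).
The converse `Coherent.noGoRes`, that white `∅` means no execution, needs no exception.

Preservation (`Coherent.step`) rests on a replacement lemma for each compound construct: a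
part may be replaced by a coherent one that exposes at least the same output color and
emitter statuses (`MState.Refines`) and whose input color is bounded by its source. Both the
start rules and the context rules are instances, the former by `Coherent.setIn`, the latter
by `Step.inC_eq_and_refines`. Under a signal declaration the replacement may increase the
status of the local signal, which `Coherent.event_mono` allows.
-/

namespace Esterel

section

open OutColor

/-! ### Gates on Scott booleans -/

namespace Scott

instance : DecidableLE Scott := fun a b => inferInstanceAs (Decidable (a = bot ∨ a = b))

theorem bot_le (a : Scott) : bot ≤ a := Or.inl rfl

theorem le_pos_of_pos {a b : Scott} (h : a ≤ b) (ha : a = pos) : b = pos := by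
  subst ha; revert h; cases b <;> decide

theorem le_neg_of_neg {a b : Scott} (h : a ≤ b) (ha : a = neg) : b = neg := by
  subst ha; revert h; cases b <;> decide

theorem not_mono {a b : Scott} (h : a ≤ b) : a.not ≤ b.not := by
  revert h; cases a <;> cases b <;> decide

theorem and_mono {a b a' b' : Scott} (h : a ≤ a') (h' : b ≤ b') : a.and b ≤ a'.and b' := by
  revert h h'; cases a <;> cases a' <;> cases b <;> cases b' <;> decide

theorem or_mono {a b a' b' : Scott} (h : a ≤ a') (h' : b ≤ b') : a.or b ≤ a'.or b' := by
  revert h h'; cases a <;> cases a' <;> cases b <;> cases b' <;> decide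

theorem and_eq_pos {a b : Scott} : a.and b = pos ↔ a = pos ∧ b = pos := by
  cases a <;> cases b <;> decide

theorem and_eq_neg {a b : Scott} : a.and b = neg ↔ a = neg ∨ b = neg := by
  cases a <;> cases b <;> decide

theorem or_eq_pos {a b : Scott} : a.or b = pos ↔ a = pos ∨ b = pos := by
  cases a <;> cases b <;> decide

theorem or_eq_neg {a b : Scott} : a.or b = neg ↔ a = neg ∧ b = neg := by
  cases a <;> cases b <;> decide

theorem not_eq_pos {a : Scott} : a.not = pos ↔ a = neg := by cases a <;> decide

theorem not_eq_neg {a : Scott} : a.not = neg ↔ a = pos := by cases a <;> decide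

theorem ofBool_eq_pos {b : Bool} : ofBool b = pos ↔ b = true := by cases b <;> decide

theorem ofBool_eq_neg {b : Bool} : ofBool b = neg ↔ b = false := by cases b <;> decide

end Scott

theorem InColor.unknown_le (i : InColor) : InColor.unknown ≤ i :=
  ⟨Scott.bot_le _, Scott.bot_le _, Scott.bot_le _⟩

/-! ### Gates on output colors -/

namespace OutColor

@[simp] theorem white_le_white {K L : Finset ℕ} : white K ≤ white L ↔ L ⊆ K := Iff.rfl

@[simp] theorem white_le_black {K : Finset ℕ} {k : ℕ} : white K ≤ black k ↔ k ∈ K :=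
  Iff.rfl

@[simp] theorem black_le_black {k l : ℕ} : black k ≤ black l ↔ k = l := Iff.rfl

@[simp] theorem not_black_le_white {k : ℕ} {K : Finset ℕ} : ¬ black k ≤ white K := id

theorem eq_black_of_le {o o' : OutColor} {k : ℕ} (h : o ≤ o') (ho : o = black k) :
    o' = black k := by
  subst ho; cases o' <;> simp_all

theorem eq_white_empty_of_le {o o' : OutColor} (h : o ≤ o') (ho : o = white ∅) :
    o' = white ∅ := by
  subst ho; cases o' <;> simp_all

theorem map_mono (f : ℕ → ℕ) {o o' : OutColor} (h : o ≤ o') : o.map f ≤ o'.map f := by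
  cases o <;> cases o' <;> simp_all [map]
  · exact ⟨_, h, rfl⟩
  · exact Finset.image_subset_image h

theorem minusZero_mono {o o' : OutColor} (h : o ≤ o') : o.minusZero ≤ o'.minusZero := by
  rcases o with (_ | k) | K <;> rcases o' with (_ | l) | L <;> simp_all [minusZero]
  exact h.trans (Finset.subset_insert _ _)

theorem minusZero_eq_black {o : OutColor} {k : ℕ} :
    o.minusZero = black k ↔ o = black k ∧ k ≠ 0 := by
  rcases o with (_ | l) | L <;> simp [minusZero] <;> omega

/-- An OR gate per wire is monotone as long as two different codes never meet. -/
theorem union_mono {a b a' b' : OutColor} (h : a ≤ a') (h' : b ≤ b')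
    (hc : ∀ k l, a' = black k → b' = black l → k = l) : a.union b ≤ a'.union b' := by
  cases a <;> cases a' <;> cases b <;> cases b' <;> simp_all [union]
  exact Finset.union_subset_union h h'

theorem suspNow_mono_left {u u' : Scott} (h : u ≤ u') (o : OutColor) :
    suspNow u o ≤ suspNow u' o := by
  rcases h with rfl | rfl
  · cases u' with
    | bot => exact le_rfl
    | pos =>
      rcases o with (_ | k) | K
      · simp [suspNow]
      · simp [suspNow, union]
      · simp only [suspNow, union, reduceCtorEq, if_false]
        split_ifs with hK
        · simp
        · exact Finset.union_subset_union subset_rfl Finset.sdiff_subset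
    | neg =>
      rcases o with (_ | k) | K <;> simp [suspNow, union]
  · exact le_rfl

theorem suspNow_mono_right (u : Scott) {o o' : OutColor} (h : o ≤ o') :
    suspNow u o ≤ suspNow u o' := by
  cases u with
  | bot =>
    rcases o with (_ | k) | K <;> rcases o' with (_ | l) | L <;>
      simp_all [suspNow, union, Finset.insert_subset_iff]
    exact h.trans (Finset.subset_insert _ _)
  | pos =>
    rcases o with (_ | k) | K <;> rcases o' with (_ | l) | L
    any_goals simp_all [suspNow]
    · simp [Finset.ne_empty_of_mem h]
    · simp [Finset.ne_empty_of_mem h, h]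
    · split_ifs <;> simp_all
      exact Finset.insert_subset_insert _ (Finset.sdiff_subset_sdiff h subset_rfl)
  | neg => exact h

theorem suspNow_eq_white_empty {u : Scott} {o : OutColor} (h : suspNow u o = white ∅) :
    u = .neg ∧ o = white ∅ := by
  rcases u <;> rcases o with (_ | k) | K <;> simp_all [suspNow, union]
  split_ifs at h
  simp at h

theorem union_eq_white_empty {a b : OutColor} (h : a.union b = white ∅) :
    a = white ∅ ∧ b = white ∅ := by
  cases a <;> cases b <;> simp_all [union, Finset.union_eq_empty]

theorem synchronize_eq_white_empty {σ τ : Bool} {a b : OutColor}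
    (h : synchronize σ τ a b = white ∅) : a = white ∅ ∧ b = white ∅ := by
  cases a <;> cases b <;> simp_all [synchronize]
  all_goals split_ifs at h; simp_all

theorem union_eq_black {a b : OutColor} {k : ℕ} (h : a.union b = black k) :
    (a = black k ∨ b = black k) := by
  cases a <;> cases b <;> simp_all [union]
  omega

theorem synchronize_eq_black {σ τ : Bool} {a b : OutColor} {k : ℕ}
    (h : synchronize σ τ a b = black k) : a = black k ∨ b = black k := by
  cases a <;> cases b <;> simp only [synchronize] at h <;> (try split_ifs at h) <;> simp_all
  omega

theorem maxCodes_mono {K K' L L' : Finset ℕ} (h : K ⊆ K') (h' : L ⊆ L') :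
    maxCodes K L ⊆ maxCodes K' L' :=
  Finset.image_subset_image (Finset.product_subset_product h h')

theorem max_mem_maxCodes {K L : Finset ℕ} {k l : ℕ} (hk : k ∈ K) (hl : l ∈ L) :
    max k l ∈ maxCodes K L :=
  Finset.mem_image.2 ⟨(k, l), Finset.mk_mem_product hk hl, rfl⟩

theorem maxCodes_comm (K L : Finset ℕ) : maxCodes K L = maxCodes L K := by
  ext n
  simp only [maxCodes, Finset.mem_image, Finset.mem_product, Prod.exists]
  exact ⟨fun ⟨k, l, h, e⟩ => ⟨l, k, h.symm, max_comm k l ▸ e⟩,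
    fun ⟨l, k, h, e⟩ => ⟨k, l, h.symm, max_comm l k ▸ e⟩⟩

theorem synchronize_comm (σ τ : Bool) (a b : OutColor) :
    synchronize σ τ a b = synchronize τ σ b a := by
  cases a <;> cases b <;>
    simp [synchronize, max_comm, maxCodes_comm, eq_comm, Finset.union_comm]

/-- If the Sel values agree or `b` is not black, a branch `a` that turns black may
contribute any of its possible codes. If they differ, only the code of `b` is possible. -/
theorem synchronize_mono_left {σ τ : Bool} {a b a' : OutColor} (h : a ≤ a')
    (hc : σ ≠ τ → ∀ k l, a' = black k → b = black l → k = l) :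
    synchronize σ τ a b ≤ synchronize σ τ a' b := by
  rcases a with k | K
  · rw [eq_black_of_le h rfl]
  rcases a' with k | K' <;> rcases b with l | L <;> simp only [synchronize]
  · have hk : k ∈ K := h
    split_ifs with h₁
    · rcases h₁ with rfl | h₁
      · simp at hk
      · simp [hc h₁ k l rfl rfl]
    · exact Finset.mem_union_right _ (max_mem_maxCodes hk (Finset.mem_singleton_self l))
  · have hk : k ∈ K := h
    split_ifs
    · exact Finset.mem_union_left _ (Finset.mem_union_left _ hk)
    · have hK : {k} ⊆ K := Finset.singleton_subset_iff.2 hk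
      exact Finset.union_subset_union (hK.trans Finset.subset_union_left)
        (maxCodes_mono hK subset_rfl)
  · have hK : K' ⊆ K := h
    split_ifs with h₁ h₂ h₂
    · exact le_rfl
    · rcases h₁ with rfl | h₁
      · exact absurd (Or.inl (Finset.subset_empty.1 hK)) h₂
      · exact absurd (Or.inr h₁) h₂
    · simp
    · exact Finset.union_subset_union subset_rfl (maxCodes_mono hK subset_rfl)
  · have hK : K' ⊆ K := h
    exact Finset.union_subset_union (Finset.union_subset_union hK subset_rfl)
      (maxCodes_mono hK subset_rfl)

/-- The synchronizer is monotone as long as branches with different Sel values do not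
return different codes. -/
theorem synchronize_mono {σ τ : Bool} {a b a' b' : OutColor} (h : a ≤ a') (h' : b ≤ b')
    (hc : σ ≠ τ → ∀ k l, a' = black k → b' = black l → k = l) :
    synchronize σ τ a b ≤ synchronize σ τ a' b' := by
  refine (synchronize_mono_left h fun hn k l hk hl =>
    hc hn k l hk (eq_black_of_le h' hl)).trans ?_
  rw [synchronize_comm σ τ a' b, synchronize_comm σ τ a' b']
  exact synchronize_mono_left h' fun hn k l hk hl => (hc hn.symm l k hl hk).symm

theorem seqGo_mono {o o' : OutColor} (h : o ≤ o') : seqGo o ≤ seqGo o' := by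
  rcases o with (_ | k) | K <;> rcases o' with (_ | l) | L <;> simp_all [seqGo]
  · exact Scott.bot_le _
  · split_ifs
    · exact Scott.bot_le _
    · exact le_rfl
  · split_ifs with h₁ h₂ h₂
    · exact le_rfl
    · exact Scott.bot_le _
    · exact absurd (h h₂) h₁
    · exact le_rfl

theorem seqGo_eq_pos {o : OutColor} : seqGo o = .pos ↔ o = black 0 := by
  rcases o with (_ | k) | K <;> simp [seqGo]
  split_ifs <;> simp

theorem seqGo_eq_neg {o : OutColor} : seqGo o = .neg ↔ ¬ o ≤ black 0 := by
  rcases o with (_ | k) | K <;> simp [seqGo]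

end OutColor

/-! ### Input and output colors of a node -/

namespace Colors

/-- Admissibility is inherited by parts that carry less information. -/
theorem Admissible.of_le {c d : Colors} (hd : d.Admissible)
    (hs : c.sel = true → d.sel = true) (hi : c.inp ≤ d.inp) : c.Admissible := by
  refine ⟨fun h => hd.1 ⟨hs h.1, Scott.le_pos_of_pos hi.1 h.2⟩, fun h => ?_⟩
  have h' := hd.2 (Scott.le_pos_of_pos hi.2.2 h)
  exact ⟨fun hg => h'.1 (Scott.le_pos_of_pos hi.1 hg),
    fun hr => h'.2 (Scott.le_pos_of_pos hi.2.1 hr)⟩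

theorem Admissible.susp_ne_pos {c : Colors} (hc : c.Admissible) (h : c.GoRes) :
    c.inp.susp ≠ .pos := fun hs =>
  h.elim (hc.2 hs).1 fun h => (hc.2 hs).2 h.2

theorem GoRes.of_part {c d : Colors} (h : d.GoRes) (hg : d.inp.go = .pos → c.inp.go = .pos)
    (hs : d.sel = true → c.sel = true) (hr : d.inp.res = .pos → c.inp.res = .pos) :
    c.GoRes :=
  h.imp hg fun h => ⟨hs h.1, hr h.2⟩

theorem GoRes.not_noGoRes {c : Colors} (h : c.GoRes) : ¬ c.NoGoRes := by
  rintro ⟨hg, hr⟩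
  rcases h with h | ⟨hs, h⟩ <;> simp_all

theorem GoRes.mono {c d : Colors} (h : c.GoRes) (hs : c.sel = d.sel) (hi : c.inp ≤ d.inp) :
    d.GoRes :=
  h.of_part (Scott.le_pos_of_pos hi.1) (fun h => hs ▸ h) (Scott.le_pos_of_pos hi.2.1)

theorem NoGoRes.mono {c d : Colors} (h : c.NoGoRes) (hs : c.sel = d.sel)
    (hi : c.inp ≤ d.inp) : d.NoGoRes :=
  ⟨Scott.le_neg_of_neg hi.1 h.1,
    h.2.imp (fun h => hs ▸ h) (Scott.le_neg_of_neg hi.2.1)⟩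

theorem OutBetween.mono {c d : Colors} {K : Finset ℕ} {o o' : OutColor}
    (h : c.OutBetween K o) (hc : c.out = d.out) (ho : o ≤ o') : d.OutBetween K o' :=
  ⟨hc ▸ h.1, hc ▸ h.2.trans ho⟩

end Colors

theorem leafOut_mono (k : ℕ) {a b : Scott} (h : a ≤ b) : leafOut k a ≤ leafOut k b := by
  rcases h with rfl | rfl
  · cases b <;> simp [leafOut]
  · exact le_rfl

theorem leafOut_eq_black {k l : ℕ} {a : Scott} (h : leafOut k a = black l) : a = .pos := by
  cases a <;> simp_all [leafOut]

theorem leafOut_eq_white_empty {k : ℕ} {a : Scott} (h : leafOut k a = white ∅) :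
    a = .neg := by
  cases a <;> simp_all [leafOut]

theorem pauseOut_mono {c d : Colors} (hs : c.sel = d.sel) (hi : c.inp ≤ d.inp)
    (hd : d.Admissible) : pauseOut c ≤ pauseOut d := by
  by_cases hg' : d.inp.go = .pos
  · have hnot : ¬ (c.sel = true ∧ c.inp.res = .pos ∧ c.inp.susp = .neg) :=
      fun h => hd.1 ⟨hs ▸ h.1, hg'⟩
    by_cases hg : c.inp.go = .pos
    · simp [pauseOut, hg, hg']
    · have hn : c.inp.go ≠ .neg := fun h => by simp [Scott.le_neg_of_neg hi.1 h] at hg'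
      simp [pauseOut, hg, hg', hnot, hn]
  have hg : c.inp.go ≠ .pos := fun h => hg' (Scott.le_pos_of_pos hi.1 h)
  by_cases hr' : d.sel = true ∧ d.inp.res = .pos ∧ d.inp.susp = .neg
  · by_cases hr : c.sel = true ∧ c.inp.res = .pos ∧ c.inp.susp = .neg
    · simp [pauseOut, hg, hg', hr, hr']
    · have hn : ¬ (c.inp.res = .neg ∨ c.sel = false) := by
        rintro (h | h)
        · simp [Scott.le_neg_of_neg hi.2.1 h] at hr'
        · simp [← hs, h] at hr'
      unfold pauseOut
      rw [if_neg hg, if_neg hg', if_neg hr, if_pos hr', if_neg hn]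
      simp
  · have hr : ¬ (c.sel = true ∧ c.inp.res = .pos ∧ c.inp.susp = .neg) := fun h =>
      hr' ⟨hs ▸ h.1, Scott.le_pos_of_pos hi.2.1 h.2.1, Scott.le_neg_of_neg hi.2.2 h.2.2⟩
    unfold pauseOut
    rw [if_neg hg, if_neg hg', if_neg hr, if_neg hr']
    refine Finset.union_subset_union ?_ ?_
    · split_ifs with h₁ h₂ h₂
      any_goals simp
      exact h₁ (h₂.imp (Scott.le_neg_of_neg hi.2.1) (fun h => hs ▸ h))
    · split_ifs with h₁ h₂ h₂
      any_goals simp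
      exact h₁ (Scott.le_neg_of_neg hi.1 h₂)

theorem pauseOut_goRes {c : Colors} {k : ℕ} (h : pauseOut c = black k) : c.GoRes := by
  unfold pauseOut at h
  split_ifs at h with h₁ h₂
  exacts [Or.inl h₁, Or.inr ⟨h₂.1, h₂.2.1⟩]

theorem pauseOut_noGoRes {c : Colors} (h : pauseOut c = white ∅) : c.NoGoRes := by
  unfold pauseOut at h
  split_ifs at h with h₁ h₂ h₃ h₄ h₄
  all_goals simp_all [Colors.NoGoRes, or_comm]

theorem awaitOut_mono {c d : Colors} {b b' : Scott} (hs : c.sel = d.sel)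
    (hi : c.inp ≤ d.inp) (hb : b ≤ b') : awaitOut c b ≤ awaitOut d b' := by
  by_cases hg : c.GoRes
  · have hg' := hg.mono hs hi
    have hn := hg.not_noGoRes
    have hn' := hg'.not_noGoRes
    rcases hb with rfl | rfl
    · cases b' <;> simp [awaitOut, hg, hg', hn, hn']
    · cases b <;> simp [awaitOut, hg, hg', hn, hn']
  by_cases hn : c.NoGoRes
  · have hn' := hn.mono hs hi
    have hg' : ¬ d.GoRes := fun h => h.not_noGoRes hn'
    simp [awaitOut, hg, hn, hg', hn']
  · by_cases hg' : d.GoRes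
    · have hn' := hg'.not_noGoRes
      rcases hb with rfl | rfl
      · cases b' <;> simp [awaitOut, hg, hg', hn, hn']
      · cases b <;> simp [awaitOut, hg, hg', hn, hn']
    · by_cases hn' : d.NoGoRes
      · simp [awaitOut, hg, hg', hn, hn']
      · rcases hb with rfl | rfl
        · cases b' <;> simp [awaitOut, hg, hg', hn, hn']
        · simp [awaitOut, hg, hg', hn, hn']

theorem awaitOut_goRes {c : Colors} {b : Scott} {k : ℕ} (h : awaitOut c b = black k) :
    c.GoRes := by
  unfold awaitOut at h
  split_ifs at h with h₁ h₂
  exacts [h₁.1, h₂.1]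

theorem awaitOut_noGoRes {c : Colors} {b : Scott} (h : awaitOut c b = white ∅) :
    c.NoGoRes := by
  unfold awaitOut at h
  split_ifs at h with h₁ h₂ h₃ 
  · exact h₃
  all_goals simp_all

end

section

open OutColor

variable {S : Type*}

/-! ### Refinement of a part -/

namespace MState

@[simp] theorem sel_setIn (i : InColor) (p : MState S) : (p.setIn i).sel = p.sel := by
  cases p <;> rfl

@[simp] theorem inC_setIn (i : InColor) (p : MState S) : (p.setIn i).inC = i := by
  cases p <;> rfl

@[simp] theorem outC_setIn (i : InColor) (p : MState S) : (p.setIn i).outC = p.outC := by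
  cases p <;> rfl

@[simp] theorem base_setIn (i : InColor) (p : MState S) : (p.setIn i).base = p.base := by
  cases p <;> rfl

@[simp] theorem emitted_setIn [DecidableEq S] (s : S) (i : InColor) (p : MState S) :
    (p.setIn i).emitted s = p.emitted s := by
  cases p <;> rfl

theorem localStatus_eq_emitted [DecidableEq S] (s : S) (p : MState S) (E : Event S) :
    p.localStatus s E = p.emitted s := by
  simp [localStatus, toEvent, Event.val, Event.add]

/-- `p'` is obtained from `p` without losing information that is visible from outside:
it is what a surrounding node may assume when a part `p` is replaced by `p'`. The input
color of the root is not mentioned; it is controlled from outside. -/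
structure Refines [DecidableEq S] (p p' : MState S) : Prop where
  sel_eq : p'.sel = p.sel
  base_eq : p'.base = p.base
  outC_le : p.outC ≤ p'.outC
  emitted_le : ∀ s, p.emitted s ≤ p'.emitted s

theorem refines_setIn [DecidableEq S] (p : MState S) (i : InColor) :
    p.Refines (p.setIn i) :=
  ⟨by simp, by simp, by simp, by simp⟩

theorem Refines.codes_eq [DecidableEq S] {p p' : MState S} (h : p.Refines p') :
    p'.codes = p.codes := congrArg Cmd.codes h.base_eq

end MState

open MState

theorem suspendRes_congr {E : Event S} {c : Colors} {s : S} {p p' : MState S}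
    (h : p'.sel = p.sel) : suspendRes E c s p' = suspendRes E c s p := by
  rw [suspendRes, suspendRes, h]

theorem suspendSusp_congr {E : Event S} {c : Colors} {s : S} {p p' : MState S}
    (h : p'.sel = p.sel) : suspendSusp E c s p' = suspendSusp E c s p := by
  rw [suspendSusp, suspendSusp, h]

theorem suspendRes_mono {E E' : Event S} {c c' : Colors} {s : S} (p : MState S)
    (hE : E.val s ≤ E'.val s) (hc : c.inp ≤ c'.inp) :
    suspendRes E c s p ≤ suspendRes E' c' s p :=
  Scott.and_mono (Scott.and_mono hc.2.1 le_rfl) (Scott.not_mono hE)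

theorem suspendSusp_mono {E E' : Event S} {c c' : Colors} {s : S} (p : MState S)
    (hE : E.val s ≤ E'.val s) (hc : c.inp ≤ c'.inp) :
    suspendSusp E c s p ≤ suspendSusp E' c' s p :=
  Scott.or_mono hc.2.2 (Scott.and_mono (Scott.and_mono hc.2.1 le_rfl) hE)

theorem suspendRes_eq_pos {E : Event S} {c : Colors} {s : S} {p : MState S} :
    suspendRes E c s p = .pos ↔ (c.inp.res = .pos ∧ p.sel = true) ∧ E.val s = .neg := by
  rw [suspendRes, Scott.and_eq_pos, Scott.and_eq_pos, Scott.ofBool_eq_pos, Scott.not_eq_pos]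

theorem suspendRes_eq_neg {E : Event S} {c : Colors} {s : S} {p : MState S} :
    suspendRes E c s p = .neg ↔ (c.inp.res = .neg ∨ p.sel = false) ∨ E.val s = .pos := by
  rw [suspendRes, Scott.and_eq_neg, Scott.and_eq_neg, Scott.ofBool_eq_neg, Scott.not_eq_neg]

theorem suspendSusp_eq_pos {E : Event S} {c : Colors} {s : S} {p : MState S} :
    suspendSusp E c s p = .pos ↔
      c.inp.susp = .pos ∨ (c.inp.res = .pos ∧ p.sel = true) ∧ E.val s = .pos := by
  rw [suspendSusp, Scott.or_eq_pos, Scott.and_eq_pos, Scott.and_eq_pos, Scott.ofBool_eq_pos]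

theorem suspendSusp_eq_neg {E : Event S} {c : Colors} {s : S} {p : MState S} :
    suspendSusp E c s p = .neg ↔
      c.inp.susp = .neg ∧ ((c.inp.res = .neg ∨ p.sel = false) ∨ E.val s = .neg) := by
  rw [suspendSusp, Scott.or_eq_neg, Scott.and_eq_neg, Scott.and_eq_neg, Scott.ofBool_eq_neg]

/-! ### Output colors reveal the input -/

variable [DecidableEq S] {E : Event S}

theorem Coherent.admissible {p : MState S} (h : Coherent E p) : p.colors.Admissible := by
  cases p <;> exact h.1

/-- The statement is executed, or it is frozen and its return code can only come from a
suspension, which returns 1. -/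
def Colors.ActiveWith (c : Colors) (k : ℕ) : Prop :=
  c.GoRes ∨ c.inp.susp = .pos ∧ k = 1

theorem Colors.ActiveWith.of_part {c d : Colors} {k : ℕ} (h : d.ActiveWith k)
    (hg : d.inp.go = .pos → c.inp.go = .pos) (hs : d.sel = true → c.sel = true)
    (hr : d.inp.res = .pos → c.inp.res = .pos) (hu : d.inp.susp = .pos → c.inp.susp = .pos) :
    c.ActiveWith k :=
  h.imp (fun h => h.of_part hg hs hr) fun h => ⟨hu h.1, h.2⟩

theorem Colors.ActiveWith.of_same_input {c d : Colors} {k : ℕ} (h : d.ActiveWith k)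
    (hs : d.sel = true → c.sel = true) (hi : d.inp ≤ c.inp) : c.ActiveWith k :=
  h.of_part (Scott.le_pos_of_pos hi.1) hs (Scott.le_pos_of_pos hi.2.1)
    (Scott.le_pos_of_pos hi.2.2)

/-- A wire of code other than 1 certifies execution even in a frozen statement. -/
theorem Colors.ActiveWith.goRes {c : Colors} {k : ℕ} (h : c.ActiveWith k) (hk : k ≠ 1) :
    c.GoRes :=
  h.resolve_right fun h => hk h.2

/-- Control is only propagated, frozen statements included. The latter matters because
parts of a node that is not frozen may be frozen. -/
theorem Coherent.activeWith {p : MState S} {k : ℕ} (h : Coherent E p)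
    (hk : p.outC = black k) : p.colors.ActiveWith k := by
  induction p generalizing E k with
  | nothing c => exact Or.inl (Or.inl (leafOut_eq_black (eq_black_of_le h.2.2.2 hk)))
  | pause c => exact Or.inl (pauseOut_goRes (eq_black_of_le h.2.2 hk))
  | exit c n => exact Or.inl (Or.inl (leafOut_eq_black (eq_black_of_le h.2.2.2 hk)))
  | emit c s => exact Or.inl (Or.inl (leafOut_eq_black (eq_black_of_le h.2.2.2.2 hk)))
  | awaitImm c s => exact Or.inl (awaitOut_goRes (eq_black_of_le h.2.2.2 hk))
  | trap c p ih =>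
    obtain ⟨-, hp, hs, hi, ho⟩ := h
    have ho := eq_black_of_le ho.2 hk
    cases hpo : p.outC with
    | white K => simp [hpo, OutColor.map] at ho
    | black l =>
      refine ((ih hp hpo).of_same_input (fun h => hs.trans h) hi).imp_right fun h => ⟨h.1, ?_⟩
      simp only [hpo, OutColor.map, black.injEq, h.2] at ho
      exact ho.symm
  | shift c p ih =>
    obtain ⟨-, hp, hs, hi, ho⟩ := h
    have ho := eq_black_of_le ho.2 hk
    cases hpo : p.outC with
    | white K => simp [hpo, OutColor.map] at ho
    | black l =>
      refine ((ih hp hpo).of_same_input (fun h => hs.trans h) hi).imp_right fun h => ⟨h.1, ?_⟩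
      simp only [hpo, OutColor.map, black.injEq, h.2] at ho
      exact ho.symm
  | suspend c s p ih =>
    obtain ⟨ha, -, hp, hs, hi, ho⟩ := h
    have ho := eq_black_of_le ho.2 hk
    have hgr : p.colors.GoRes → c.GoRes := fun h =>
      h.of_part (Scott.le_pos_of_pos hi.1) (fun h => hs.trans h)
        fun h => (suspendRes_eq_pos.1 (Scott.le_pos_of_pos hi.2.1 h)).1.1
    cases hu : suspendSusp E c s p with
    | pos =>
      rcases suspendSusp_eq_pos.1 hu with hu | hu
      · refine Or.inr ⟨hu, ?_⟩
        cases hpo : p.outC with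
        | white K =>
          simp only [suspendSusp_eq_pos.2 (Or.inl hu), suspNow, hpo] at ho
          split_ifs at ho
          exact (black.inj ho).symm
        | black l =>
          have hl : l = 1 := ((ih hp hpo).resolve_left fun h =>
            ha.susp_ne_pos (hgr h) hu).2
          simp only [suspendSusp_eq_pos.2 (Or.inl hu), suspNow, hpo, hl] at ho
          exact (black.inj ho).symm
      · exact Or.inl (Or.inr ⟨hs.trans hu.1.2, hu.1.1⟩)
    | bot =>
      have hpo : p.outC = black k := by
        rw [hu] at ho
        cases hpo : p.outC <;> simp only [hpo, suspNow, union] at ho <;> split_ifs at ho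
        exact ho
      refine Or.inl (hgr ((ih hp hpo).resolve_right fun h => ?_))
      have := Scott.le_pos_of_pos hi.2.2 h.1
      simp [hu] at this
    | neg =>
      rw [hu] at ho
      refine Or.inl (hgr ((ih hp ho).resolve_right fun h => ?_))
      have := Scott.le_pos_of_pos hi.2.2 h.1
      simp [hu] at this
  | test c s p q ihp ihq =>
    obtain ⟨-, -, hp, hq, hs, -, hi, hj, ho⟩ := h
    rcases union_eq_black (eq_black_of_le ho.2 hk) with ho | ho
    · exact (ihp hp ho).of_part
        (fun h => (Scott.and_eq_pos.1 (Scott.le_pos_of_pos hi.1 h)).1)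
        (fun h => hs.trans (by simp [MState.sel, h]))
        (Scott.le_pos_of_pos hi.2.1) (Scott.le_pos_of_pos hi.2.2)
    · exact (ihq hq ho).of_part
        (fun h => (Scott.and_eq_pos.1 (Scott.le_pos_of_pos hj.1 h)).1)
        (fun h => hs.trans (by simp [MState.sel, h]))
        (Scott.le_pos_of_pos hj.2.1) (Scott.le_pos_of_pos hj.2.2)
  | seq c p q ihp ihq =>
    obtain ⟨-, hp, hq, hs, -, hi, hj, ho⟩ := h
    have hsp : p.sel = true → c.sel = true := fun h => hs.trans (by simp [h])
    rcases union_eq_black (eq_black_of_le ho.2 hk) with ho | ho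
    · exact (ihp hp (minusZero_eq_black.1 ho).1).of_same_input hsp hi
    · rcases ihq hq ho with (h | h) | h
      -- The second part has been started, so the first one has returned code 0.
      · have h0 := seqGo_eq_pos.1 (Scott.le_pos_of_pos hj.1 h)
        exact Or.inl (((ihp hp h0).of_same_input hsp hi).goRes zero_ne_one)
      · exact Or.inl (Or.inr ⟨hs.trans (by simp [MState.sel, h.1]),
          Scott.le_pos_of_pos hj.2.1 h.2⟩)
      · exact Or.inr ⟨Scott.le_pos_of_pos hj.2.2 h.1, h.2⟩
  | par c p q ihp ihq =>
    obtain ⟨-, hp, hq, hs, hi, hj, ho⟩ := h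
    rcases synchronize_eq_black (eq_black_of_le ho.2 hk) with ho | ho
    · exact (ihp hp ho).of_same_input (fun h => hs.trans (by simp [MState.sel, h])) hi
    · exact (ihq hq ho).of_same_input (fun h => hs.trans (by simp [MState.sel, h])) hj
  | signal c s p ih =>
    obtain ⟨-, hp, hs, hi, ho⟩ := h
    exact (ih hp (eq_black_of_le ho.2 hk)).of_same_input (fun h => hs.trans h) hi

/-- If all return code wires are 0, then the statement is not executed. -/
theorem Coherent.noGoRes {p : MState S} (h : Coherent E p) (ho : p.outC = white ∅) :
    p.colors.NoGoRes := by
  induction p generalizing E with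
  | nothing c =>
    exact ⟨leafOut_eq_white_empty (eq_white_empty_of_le h.2.2.2 ho), Or.inl h.2.1⟩
  | pause c => exact pauseOut_noGoRes (eq_white_empty_of_le h.2.2 ho)
  | exit c n =>
    exact ⟨leafOut_eq_white_empty (eq_white_empty_of_le h.2.2.2 ho), Or.inl h.2.1⟩
  | emit c s =>
    exact ⟨leafOut_eq_white_empty (eq_white_empty_of_le h.2.2.2.2 ho), Or.inl h.2.2.1⟩
  | awaitImm c s => exact awaitOut_noGoRes (eq_white_empty_of_le h.2.2.2 ho)
  | trap c p ih | shift c p ih =>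
    obtain ⟨-, hp, hs, hi, ho'⟩ := h
    have ho := eq_white_empty_of_le ho'.2 ho
    refine (ih hp ?_).mono hs.symm hi
    cases hpo : p.outC <;> simp_all [OutColor.map]
  | suspend c s p ih =>
    obtain ⟨-, -, hp, hs, hi, ho'⟩ := h
    obtain ⟨hu, ho⟩ := suspNow_eq_white_empty (eq_white_empty_of_le ho'.2 ho)
    obtain ⟨hg, hr⟩ := ih hp ho
    refine ⟨Scott.le_neg_of_neg hi.1 hg, ?_⟩
    rcases hr with hr | hr
    · exact Or.inl (hs.trans hr)
    -- The conditions of the two gates on the Res wire are complementary.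
    · have hr := suspendRes_eq_neg.1 (Scott.le_neg_of_neg hi.2.1 hr)
      have hu := (suspendSusp_eq_neg.1 hu).2
      rw [← hs] at hr hu
      rcases hu with hu | hu
      · exact hu.symm
      · exact (hr.resolve_right (by simp [hu])).symm
  | test c s p q ihp ihq =>
    obtain ⟨-, -, hp, hq, hs, -, hi, hj, ho'⟩ := h
    obtain ⟨hop, hoq⟩ := union_eq_white_empty (eq_white_empty_of_le ho'.2 ho)
    obtain ⟨hgp, hrp⟩ := ihp hp hop
    obtain ⟨hgq, hrq⟩ := ihq hq hoq
    constructor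
    · rcases Scott.and_eq_neg.1 (Scott.le_neg_of_neg hi.1 hgp) with h | h
      · exact h
      · refine (Scott.and_eq_neg.1 (Scott.le_neg_of_neg hj.1 hgq)).resolve_right ?_
        simp [Scott.not_eq_neg, h]
    · rcases hrp with hrp | hrp
      · rcases hrq with hrq | hrq
        · exact Or.inl (hs.trans (by simp [MState.sel, hrp, hrq]))
        · exact Or.inr (Scott.le_neg_of_neg hj.2.1 hrq)
      · exact Or.inr (Scott.le_neg_of_neg hi.2.1 hrp)
  | seq c p q ihp ihq =>
    obtain ⟨-, hp, hq, hs, -, hi, hj, ho'⟩ := h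
    obtain ⟨hop, hoq⟩ := union_eq_white_empty (eq_white_empty_of_le ho'.2 ho)
    obtain ⟨hgq, hrq⟩ := ihq hq hoq
    -- The second part is not started, so code 0 of the first one is 0 as well.
    have h0 := seqGo_eq_neg.1 (Scott.le_neg_of_neg hj.1 hgq)
    have hop : p.outC = white ∅ := by
      rcases hpo : p.outC with (_ | k) | K <;>
        simp_all [minusZero, Finset.sdiff_eq_empty_iff_subset, Finset.subset_singleton_iff]
      rcases hop with rfl | rfl <;> simp_all
    obtain ⟨hgp, hrp⟩ := ihp hp hop
    refine ⟨Scott.le_neg_of_neg hi.1 hgp, ?_⟩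
    rcases hrp with hrp | hrp
    · rcases hrq with hrq | hrq
      · exact Or.inl (hs.trans (by simp [MState.sel, hrp, hrq]))
      · exact Or.inr (Scott.le_neg_of_neg hj.2.1 hrq)
    · exact Or.inr (Scott.le_neg_of_neg hi.2.1 hrp)
  | par c p q ihp ihq =>
    obtain ⟨-, hp, hq, hs, hi, hj, ho'⟩ := h
    obtain ⟨hop, hoq⟩ := synchronize_eq_white_empty (eq_white_empty_of_le ho'.2 ho)
    obtain ⟨hgp, hrp⟩ := ihp hp hop
    obtain ⟨hgq, hrq⟩ := ihq hq hoq
    refine ⟨Scott.le_neg_of_neg hi.1 hgp, ?_⟩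
    rcases hrp with hrp | hrp
    · rcases hrq with hrq | hrq
      · exact Or.inl (hs.trans (by simp [MState.sel, hrp, hrq]))
      · exact Or.inr (Scott.le_neg_of_neg hj.2.1 hrq)
    · exact Or.inr (Scott.le_neg_of_neg hi.2.1 hrp)
  | signal c s p ih =>
    obtain ⟨-, hp, hs, hi, ho'⟩ := h
    exact (ih hp (eq_white_empty_of_le ho'.2 ho)).mono hs.symm hi

end

section

open OutColor MState

variable {S : Type*} {E E' : Event S}

/-! ### Parts that exclude each other -/

/-- Two parts are not executed simultaneously unless they are started simultaneously, since
a selected statement is not started. -/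
theorem Colors.not_goRes_and_goRes {c d e : Colors} (ha : c.Admissible)
    (hs : c.sel = (d.sel || e.sel)) (hex : ¬ (d.sel = true ∧ e.sel = true))
    (hd : d.inp.go = .pos → c.inp.go = .pos) (he : e.inp.go = .pos → c.inp.go = .pos)
    (hgo : ¬ (d.inp.go = .pos ∧ e.inp.go = .pos)) : ¬ (d.GoRes ∧ e.GoRes) := by
  rintro ⟨h | h, h' | h'⟩
  · exact hgo ⟨h, h'⟩
  · exact ha.1 ⟨by simp [hs, h'.1], hd h⟩
  · exact ha.1 ⟨by simp [hs, h.1], he h'⟩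
  · exact hex ⟨h.1, h'.1⟩

/-- If two parts that exclude each other both return a code, then the whole is frozen and
both codes are 1. -/
theorem Colors.ActiveWith.code_eq {c d e : Colors} {k l : ℕ} (hd : d.ActiveWith k)
    (he : e.ActiveWith l) (ha : c.Admissible) (hdc : d.GoRes → c.GoRes)
    (hec : e.GoRes → c.GoRes) (hds : d.inp.susp ≤ c.inp.susp)
    (hes : e.inp.susp ≤ c.inp.susp) (hex : ¬ (d.GoRes ∧ e.GoRes)) : k = l := by
  rcases hd with hd | ⟨hd, rfl⟩ <;> rcases he with he | ⟨he, rfl⟩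
  · exact absurd ⟨hd, he⟩ hex
  · exact absurd (Scott.le_pos_of_pos hes he) (ha.susp_ne_pos (hdc hd))
  · exact absurd (Scott.le_pos_of_pos hds hd) (ha.susp_ne_pos (hec he))
  · rfl

section Branches

variable {c : Colors} {p q : MState S}

theorem test_not_goRes {b : Scott} (ha : c.Admissible) (hs : c.sel = (p.sel || q.sel))
    (hex : ¬ (p.sel = true ∧ q.sel = true))
    (hi : p.inC ≤ ⟨c.inp.go.and b, c.inp.res, c.inp.susp⟩)
    (hj : q.inC ≤ ⟨c.inp.go.and b.not, c.inp.res, c.inp.susp⟩) :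
    ¬ (p.colors.GoRes ∧ q.colors.GoRes) := by
  have hp := fun h => Scott.and_eq_pos.1 (Scott.le_pos_of_pos hi.1 h)
  have hq := fun h => Scott.and_eq_pos.1 (Scott.le_pos_of_pos hj.1 h)
  refine Colors.not_goRes_and_goRes ha hs hex (fun h => (hp h).1) (fun h => (hq h).1) ?_
  rintro ⟨h, h'⟩
  have hb := Scott.not_eq_pos.1 (hq h').2
  simp [(hp h).2] at hb

/-- Once the first part of a sequence returns a code other than 0, the second part cannot
be started any more. -/
theorem seq_not_goRes {k : ℕ} (ha : c.Admissible) (hs : c.sel = (p.sel || q.sel))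
    (hex : ¬ (p.sel = true ∧ q.sel = true)) (hi : p.inC ≤ c.inp)
    (hj : q.inC ≤ ⟨seqGo p.outC, c.inp.res, c.inp.susp⟩)
    (hk : p.outC.minusZero = black k) : ¬ (p.colors.GoRes ∧ q.colors.GoRes) := by
  obtain ⟨hk, hk0⟩ := minusZero_eq_black.1 hk
  have hq : q.inC.go ≠ .pos := fun h => by
    have := seqGo_eq_pos.1 (Scott.le_pos_of_pos hj.1 h)
    exact hk0 (black.inj (hk.symm.trans this))
  exact Colors.not_goRes_and_goRes ha hs hex (Scott.le_pos_of_pos hi.1)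
    (fun h => absurd h hq) (fun h => hq h.2)

variable [DecidableEq S]

theorem test_code_eq {b : Scott} (hp : Coherent E p) (hq : Coherent E q)
    (ha : c.Admissible) (hs : c.sel = (p.sel || q.sel))
    (hex : ¬ (p.sel = true ∧ q.sel = true))
    (hi : p.inC ≤ ⟨c.inp.go.and b, c.inp.res, c.inp.susp⟩)
    (hj : q.inC ≤ ⟨c.inp.go.and b.not, c.inp.res, c.inp.susp⟩) :
    ∀ k l, p.outC = black k → q.outC = black l → k = l := fun _ _ hk hl =>
  (hp.activeWith hk).code_eq (hq.activeWith hl) ha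
    (fun h => h.of_part (fun h => (Scott.and_eq_pos.1 (Scott.le_pos_of_pos hi.1 h)).1)
      (fun h => hs.trans (by simp [MState.sel, h])) (Scott.le_pos_of_pos hi.2.1))
    (fun h => h.of_part (fun h => (Scott.and_eq_pos.1 (Scott.le_pos_of_pos hj.1 h)).1)
      (fun h => hs.trans (by simp [MState.sel, h])) (Scott.le_pos_of_pos hj.2.1))
    hi.2.2 hj.2.2 (test_not_goRes ha hs hex hi hj)

theorem seq_code_eq (hp : Coherent E p) (hq : Coherent E q)
    (ha : c.Admissible) (hs : c.sel = (p.sel || q.sel))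
    (hex : ¬ (p.sel = true ∧ q.sel = true)) (hi : p.inC ≤ c.inp)
    (hj : q.inC ≤ ⟨seqGo p.outC, c.inp.res, c.inp.susp⟩) :
    ∀ k l, p.outC.minusZero = black k → q.outC = black l → k = l := fun _ _ hk hl => by
  have hk' := minusZero_eq_black.1 hk
  refine (hp.activeWith hk'.1).code_eq (hq.activeWith hl) ha
    (fun h => h.of_part (Scott.le_pos_of_pos hi.1)
      (fun h => hs.trans (by simp [MState.sel, h])) (Scott.le_pos_of_pos hi.2.1))
    (fun h => h.of_part (fun h => ?_)
      (fun h => hs.trans (by simp [MState.sel, h])) (Scott.le_pos_of_pos hj.2.1))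
    hi.2.2 hj.2.2 (seq_not_goRes ha hs hex hi hj hk)
  have h0 := seqGo_eq_pos.1 (Scott.le_pos_of_pos hj.1 h)
  exact absurd (black.inj (hk'.1.symm.trans h0)) hk'.2

theorem par_code_eq (hp : Coherent E p) (hq : Coherent E q)
    (ha : c.Admissible) (hs : c.sel = (p.sel || q.sel)) (hi : p.inC ≤ c.inp)
    (hj : q.inC ≤ c.inp) (hne : p.sel ≠ q.sel) :
    ∀ k l, p.outC = black k → q.outC = black l → k = l := fun _ _ hk hl => by
  refine (hp.activeWith hk).code_eq (hq.activeWith hl) ha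
    (fun h => h.of_part (Scott.le_pos_of_pos hi.1)
      (fun h => hs.trans (by simp [MState.sel, h])) (Scott.le_pos_of_pos hi.2.1))
    (fun h => h.of_part (Scott.le_pos_of_pos hj.1)
      (fun h => hs.trans (by simp [MState.sel, h])) (Scott.le_pos_of_pos hj.2.1))
    hi.2.2 hj.2.2 ?_
  have hex : ¬ (p.sel = true ∧ q.sel = true) := fun h => hne (h.1.trans h.2.symm)
  refine Colors.not_goRes_and_goRes ha hs hex (Scott.le_pos_of_pos hi.1)
    (Scott.le_pos_of_pos hj.1) fun h => ha.1 ⟨?_, Scott.le_pos_of_pos hi.1 h.1⟩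
  rw [hs]
  revert hne
  cases p.sel <;> cases q.sel <;> decide

end Branches

/-- A suspension that takes effect withdraws Res from its body, and it can do so only when
it is selected, hence not started: the body is neither started nor resumed when frozen. -/
theorem suspend_admissible {c : Colors} {s : S} {p : MState S} (ha : c.Admissible)
    (hs : c.sel = p.sel) (o : OutColor) :
    Colors.Admissible ⟨p.sel, ⟨c.inp.go, suspendRes E c s p, suspendSusp E c s p⟩, o⟩ := by
  refine ⟨fun h => ha.1 ⟨hs.trans h.1, h.2⟩, fun hu => ?_⟩
  rcases suspendSusp_eq_pos.1 hu with hu | ⟨⟨hr, hp⟩, hE⟩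
  · exact ⟨(ha.2 hu).1, fun h => (ha.2 hu).2 (suspendRes_eq_pos.1 h).1.1⟩
  · refine ⟨fun h => ha.1 ⟨hs.trans hp, h⟩, fun h => ?_⟩
    have := (suspendRes_eq_pos.1 h).2
    simp [hE] at this

theorem test_admissible {c : Colors} {p q : MState S} {b : Scott} {σ : Bool}
    (ha : c.Admissible) (hs : c.sel = (p.sel || q.sel)) (hσ : σ = p.sel ∨ σ = q.sel)
    (o : OutColor) :
    Colors.Admissible ⟨σ, ⟨c.inp.go.and b, c.inp.res, c.inp.susp⟩, o⟩ := by
  refine ⟨fun h => ha.1 ⟨?_, (Scott.and_eq_pos.1 h.2).1⟩, fun hu =>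
    ⟨fun h => (ha.2 hu).1 (Scott.and_eq_pos.1 h).1, (ha.2 hu).2⟩⟩
  have h1 : σ = true := h.1
  rw [hs]
  rcases hσ with hσ | hσ <;> simp [← hσ, h1]

theorem Event.le_refl (E : Event S) : E ≤ E := fun _ => le_rfl

variable [DecidableEq S]

/-- Control flows from the first to the second part of a sequence only by a return code 0,
which certifies that the first part, and hence the sequence, is executed. -/
theorem seq_admissible {c : Colors} {p q : MState S} (hp : Coherent E p)
    (ha : c.Admissible) (hs : c.sel = (p.sel || q.sel))
    (hex : ¬ (p.sel = true ∧ q.sel = true)) (hi : p.inC ≤ c.inp) (o : OutColor) :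
    Colors.Admissible ⟨q.sel, ⟨seqGo p.outC, c.inp.res, c.inp.susp⟩, o⟩ := by
  have h0 : seqGo p.outC = .pos → p.colors.GoRes := fun h =>
    (hp.activeWith (seqGo_eq_pos.1 h)).goRes zero_ne_one
  refine ⟨fun ⟨hq, hg⟩ => ?_, fun hu => ⟨fun hg => ?_, (ha.2 hu).2⟩⟩
  · rcases h0 hg with h | h
    · exact ha.1 ⟨by simp [hs, show q.sel = true from hq], Scott.le_pos_of_pos hi.1 h⟩
    · exact hex ⟨h.1, hq⟩
  · refine ha.susp_ne_pos ((h0 hg).of_part (Scott.le_pos_of_pos hi.1)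
      (fun h => hs.trans (by simp [MState.sel, h])) (Scott.le_pos_of_pos hi.2.1)) hu

/-! ### Monotonicity of the invariant -/

/-- The input color of the root may grow as long as it is admissible. -/
theorem Coherent.setIn {p : MState S} {i : InColor} (h : Coherent E p) (hi : p.inC ≤ i)
    (ha : Colors.Admissible ⟨p.sel, i, p.outC⟩) : Coherent E (p.setIn i) := by
  cases p with
  | nothing c => exact ⟨ha, h.2.1, h.2.2.mono rfl (leafOut_mono _ hi.1)⟩
  | pause c => exact ⟨ha, h.2.mono rfl (pauseOut_mono rfl hi ha)⟩
  | exit c n => exact ⟨ha, h.2.1, h.2.2.mono rfl (leafOut_mono _ hi.1)⟩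
  | emit c s => exact ⟨ha, h.2.1, h.2.2.1, h.2.2.2.mono rfl (leafOut_mono _ hi.1)⟩
  | awaitImm c s => exact ⟨ha, h.2.1, h.2.2.mono rfl (awaitOut_mono rfl hi le_rfl)⟩
  | trap c p | shift c p | signal c s p =>
    obtain ⟨-, hp, hs, hi', ho⟩ := h
    exact ⟨ha, hp, hs, hi'.trans hi, ho⟩
  | suspend c s p =>
    obtain ⟨-, hd, hp, hs, hi', ho⟩ := h
    exact ⟨ha, hd, hp, hs,
      hi'.trans ⟨hi.1, suspendRes_mono p le_rfl hi, suspendSusp_mono p le_rfl hi⟩,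
      ho.mono rfl (suspNow_mono_left (suspendSusp_mono p le_rfl hi) _)⟩
  | test c s p q =>
    obtain ⟨-, hd, hp, hq, hs, hex, hi', hj', ho⟩ := h
    exact ⟨ha, hd, hp, hq, hs, hex,
      hi'.trans ⟨Scott.and_mono hi.1 le_rfl, hi.2.1, hi.2.2⟩,
      hj'.trans ⟨Scott.and_mono hi.1 le_rfl, hi.2.1, hi.2.2⟩, ho⟩
  | seq c p q =>
    obtain ⟨-, hp, hq, hs, hex, hi', hj', ho⟩ := h
    exact ⟨ha, hp, hq, hs, hex, hi'.trans hi, hj'.trans ⟨le_rfl, hi.2.1, hi.2.2⟩, ho⟩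
  | par c p q =>
    obtain ⟨-, hp, hq, hs, hi', hj', ho⟩ := h
    exact ⟨ha, hp, hq, hs, hi'.trans hi, hj'.trans hi, ho⟩

/-- A part may receive any input color between its present one and an admissible source. -/
theorem Coherent.setIn_of_source {p : MState S} {i j : InColor} (h : Coherent E p)
    (hi : p.inC ≤ i) (hij : i ≤ j) (ha : Colors.Admissible ⟨p.sel, j, p.outC⟩) :
    Coherent E (p.setIn i) :=
  h.setIn hi (ha.of_le (fun h => h) hij)

theorem Event.add_dom (s : S) (b : Scott) (E : Event S) :
    (E.add s b).dom = insert s E.dom := by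
  ext t
  by_cases h : t = s <;> simp [Event.dom, Event.add, h]

theorem Event.add_mono (s : S) {b b' : Scott} (hE : E ≤ E') (hb : b ≤ b') :
    E.add s b ≤ E'.add s b' := by
  intro t
  by_cases h : t = s
  · simpa [Event.val, Event.add, h] using hb
  · simpa [Event.val, Event.add, h] using hE t

/-- The statuses of the signals may grow. -/
theorem Coherent.event_mono {p : MState S} (h : Coherent E p) (hd : E.dom = E'.dom)
    (hE : E ≤ E') : Coherent E' p := by
  induction p generalizing E E' with
  | nothing c | pause c | exit c n => exact h
  | emit c s => exact ⟨h.1, hd ▸ h.2.1, h.2.2⟩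
  | awaitImm c s =>
    exact ⟨h.1, hd ▸ h.2.1, h.2.2.mono rfl (awaitOut_mono rfl le_rfl (hE s))⟩
  | trap c p ih | shift c p ih =>
    obtain ⟨ha, hp, hs, hi, ho⟩ := h
    exact ⟨ha, ih hp hd hE, hs, hi, ho⟩
  | suspend c s p ih =>
    obtain ⟨ha, hd', hp, hs, hi, ho⟩ := h
    exact ⟨ha, hd ▸ hd', ih hp hd hE, hs,
      hi.trans ⟨le_rfl, suspendRes_mono p (hE s) le_rfl, suspendSusp_mono p (hE s) le_rfl⟩,
      ho.mono rfl (suspNow_mono_left (suspendSusp_mono p (hE s) le_rfl) _)⟩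
  | test c s p q ihp ihq =>
    obtain ⟨ha, hd', hp, hq, hs, hex, hi, hj, ho⟩ := h
    exact ⟨ha, hd ▸ hd', ihp hp hd hE, ihq hq hd hE, hs, hex,
      hi.trans ⟨Scott.and_mono le_rfl (hE s), le_rfl, le_rfl⟩,
      hj.trans ⟨Scott.and_mono le_rfl (Scott.not_mono (hE s)), le_rfl, le_rfl⟩, ho⟩
  | seq c p q ihp ihq =>
    obtain ⟨ha, hp, hq, h⟩ := h
    exact ⟨ha, ihp hp hd hE, ihq hq hd hE, h⟩
  | par c p q ihp ihq =>
    obtain ⟨ha, hp, hq, h⟩ := h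
    exact ⟨ha, ihp hp hd hE, ihq hq hd hE, h⟩
  | signal c s p ih =>
    obtain ⟨ha, hp, hs, hi, ho⟩ := h
    refine ⟨ha, ih hp ?_ ?_, hs, hi, ho⟩
    · rw [Event.add_dom, Event.add_dom, hd]
    · rw [localStatus_eq_emitted, localStatus_eq_emitted]
      exact Event.add_mono s hE le_rfl

/-! ### Replacing the parts of a node -/

theorem MState.Refines.refl (p : MState S) : p.Refines p :=
  ⟨rfl, rfl, le_rfl, fun _ => le_rfl⟩

section Replace

variable {c : Colors} {s : S} {p p' q q' : MState S}

theorem Coherent.trap_replace (h : Coherent E (.trap c p)) (hp : Coherent E p')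
    (r : p.Refines p') (hi : p'.inC ≤ c.inp) : Coherent E (.trap c p') := by
  obtain ⟨ha, -, hs, -, ho⟩ := h
  refine ⟨ha, hp, hs.trans r.sel_eq.symm, hi, ?_⟩
  rw [r.codes_eq]
  exact ho.mono rfl (map_mono _ r.outC_le)

theorem Coherent.shift_replace (h : Coherent E (.shift c p)) (hp : Coherent E p')
    (r : p.Refines p') (hi : p'.inC ≤ c.inp) : Coherent E (.shift c p') := by
  obtain ⟨ha, -, hs, -, ho⟩ := h
  refine ⟨ha, hp, hs.trans r.sel_eq.symm, hi, ?_⟩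
  rw [r.codes_eq]
  exact ho.mono rfl (map_mono _ r.outC_le)

theorem Coherent.suspend_replace (h : Coherent E (.suspend c s p)) (hp : Coherent E p')
    (r : p.Refines p')
    (hi : p'.inC ≤ ⟨c.inp.go, suspendRes E c s p, suspendSusp E c s p⟩) :
    Coherent E (.suspend c s p') := by
  obtain ⟨ha, hd, -, hs, -, ho⟩ := h
  refine ⟨ha, hd, hp, hs.trans r.sel_eq.symm, ?_, ?_⟩
  · rwa [suspendRes_congr r.sel_eq, suspendSusp_congr r.sel_eq]
  · rw [r.codes_eq, suspendSusp_congr r.sel_eq]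
    exact ho.mono rfl (suspNow_mono_right _ r.outC_le)

theorem Coherent.test_replace (h : Coherent E (.test c s p q)) (hp : Coherent E p')
    (hq : Coherent E q') (r : p.Refines p') (r' : q.Refines q')
    (hi : p'.inC ≤ ⟨c.inp.go.and (E.val s), c.inp.res, c.inp.susp⟩)
    (hj : q'.inC ≤ ⟨c.inp.go.and (E.val s).not, c.inp.res, c.inp.susp⟩) :
    Coherent E (.test c s p' q') := by
  obtain ⟨ha, hd, -, -, hs, hex, -, -, ho⟩ := h
  rw [← r.sel_eq, ← r'.sel_eq] at hs hex
  refine ⟨ha, hd, hp, hq, hs, hex, hi, hj, ?_⟩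
  rw [r.codes_eq, r'.codes_eq]
  exact ho.mono rfl (union_mono r.outC_le r'.outC_le (test_code_eq hp hq ha hs hex hi hj))

theorem Coherent.seq_replace (h : Coherent E (.seq c p q)) (hp : Coherent E p')
    (hq : Coherent E q') (r : p.Refines p') (r' : q.Refines q') (hi : p'.inC ≤ c.inp)
    (hj : q'.inC ≤ ⟨seqGo p.outC, c.inp.res, c.inp.susp⟩) :
    Coherent E (.seq c p' q') := by
  obtain ⟨ha, -, -, hs, hex, -, -, ho⟩ := h
  rw [← r.sel_eq, ← r'.sel_eq] at hs hex
  have hj : q'.inC ≤ ⟨seqGo p'.outC, c.inp.res, c.inp.susp⟩ :=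
    hj.trans ⟨seqGo_mono r.outC_le, le_rfl, le_rfl⟩
  refine ⟨ha, hp, hq, hs, hex, hi, hj, ?_⟩
  rw [r.codes_eq, r'.codes_eq]
  exact ho.mono rfl (union_mono (minusZero_mono r.outC_le) r'.outC_le
    (seq_code_eq hp hq ha hs hex hi hj))

theorem Coherent.par_replace (h : Coherent E (.par c p q)) (hp : Coherent E p')
    (hq : Coherent E q') (r : p.Refines p') (r' : q.Refines q') (hi : p'.inC ≤ c.inp)
    (hj : q'.inC ≤ c.inp) : Coherent E (.par c p' q') := by
  obtain ⟨ha, -, -, hs, -, -, ho⟩ := h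
  rw [← r.sel_eq, ← r'.sel_eq] at hs ho
  refine ⟨ha, hp, hq, hs, hi, hj, ?_⟩
  rw [r.codes_eq, r'.codes_eq]
  exact ho.mono rfl (synchronize_mono r.outC_le r'.outC_le
    (par_code_eq hp hq ha hs hi hj))

/-- When the body of a declaration changes, the status of the local signal may grow, which
affects the whole body. -/
theorem Coherent.signal_replace (h : Coherent E (.signal c s p))
    (hp : Coherent (E.add s (p.localStatus s E)) p') (r : p.Refines p')
    (hi : p'.inC ≤ c.inp) : Coherent E (.signal c s p') := by
  obtain ⟨ha, -, hs, -, ho⟩ := h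
  refine ⟨ha, hp.event_mono ?_ ?_, hs.trans r.sel_eq.symm, hi, ?_⟩
  · rw [Event.add_dom, Event.add_dom]
  · rw [localStatus_eq_emitted, localStatus_eq_emitted]
    exact Event.add_mono s (Event.le_refl E) (r.emitted_le s)
  · rw [r.codes_eq]
    exact ho.mono rfl r.outC_le

end Replace

/-! ### Microsteps lose no information -/

/-- A microstep does not change the input color of the root and loses no information. -/
theorem Step.inC_eq_and_refines {p p' : MState S} (h : Step E p p') :
    p'.inC = p.inC ∧ p.Refines p' := by
  induction h
  -- Emitters gain a known status, which was unknown before the step.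
  case emit_nogo E c s _ _ ho =>
    refine ⟨rfl, rfl, rfl, ?_, fun t => ?_⟩
    · simp [outC, colors, ho]
    · by_cases h : s = t <;> simp [emitted, h, ho, Scott.bot_le]
  case emit_go E c s _ _ ho =>
    refine ⟨rfl, rfl, rfl, ?_, fun t => ?_⟩
    · simp [outC, colors, ho]
    · by_cases h : s = t <;> simp [emitted, h, ho, Scott.bot_le]
  case signal_ctx ih =>
    obtain ⟨-, r⟩ := ih
    refine ⟨rfl, rfl, congrArg (Cmd.signal _) r.base_eq, le_rfl, fun t => ?_⟩
    simp only [emitted]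
    split_ifs
    · exact le_rfl
    · exact r.emitted_le t
  case trap_ctx ih | shift_ctx ih | suspend_ctx ih =>
    obtain ⟨-, r⟩ := ih
    exact ⟨rfl, rfl, by simp [base, r.base_eq], le_rfl, r.emitted_le⟩
  case test_ctxL ih | seq_ctxL ih | par_ctxL ih =>
    obtain ⟨-, r⟩ := ih
    exact ⟨rfl, rfl, by simp [base, r.base_eq], le_rfl,
      fun t => Scott.or_mono (r.emitted_le t) le_rfl⟩
  case test_ctxR ih | seq_ctxR ih | par_ctxR ih =>
    obtain ⟨-, r⟩ := ih
    exact ⟨rfl, rfl, by simp [base, r.base_eq], le_rfl,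
      fun t => Scott.or_mono le_rfl (r.emitted_le t)⟩
  case trap_start | shift_start | suspend_go | suspend_res | suspend_susp | test_goL |
      test_goR | test_resL | test_resR | test_suspL | test_suspR | seq_startL | seq_resR |
      seq_suspR | seq_goR | seq_nogoR | par_startL | par_startR | signal_start =>
    refine ⟨rfl, rfl, ?_, le_rfl, fun t => ?_⟩
    · simp [base, setGo, setRes, setSusp]
    · simp [emitted, setGo, setRes, setSusp]
  case trap_end h | shift_end h | suspend_end_unknown h | suspend_end h | test_end h |
      seq_end h | par_end h | signal_end h | pause_go h | pause_res h | await_wait h |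
      await_done h =>
    exact ⟨rfl, rfl, rfl, h.le, fun t => le_rfl⟩
  case nothing_nogo ho | nothing_go ho | exit_nogo ho | exit_go ho =>
    exact ⟨rfl, rfl, rfl, by simp [outC, colors, ho], fun t => le_rfl⟩
  case pause_not0 ho _ | pause_not1 ho _ | await_not0 ho _ | await_not1 ho _ =>
    exact ⟨rfl, rfl, rfl, by simp [outC, colors, ho], fun t => le_rfl⟩

theorem Colors.OutBetween.set_out {c : Colors} {K : Finset ℕ} {o o' : OutColor}
    (h : c.OutBetween K o) (h₁ : c.out ≤ o') (h₂ : o' ≤ o) :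
    Colors.OutBetween { c with out := o' } K o :=
  ⟨h.1.trans h₁, h₂⟩

end

section

open OutColor MState

variable {S : Type*} [DecidableEq S] {E E' : Event S}

/-! ### Preservation under microsteps -/

theorem InColor.le_go {i j : InColor} {b : Scott} (h : i ≤ j) (hi : i.go ≤ b)
    (hj : b ≤ j.go) : i ≤ { i with go := b } ∧ { i with go := b } ≤ j :=
  ⟨⟨hi, le_rfl, le_rfl⟩, hj, h.2⟩

theorem InColor.le_res {i j : InColor} {b : Scott} (h : i ≤ j) (hi : i.res ≤ b)
    (hj : b ≤ j.res) : i ≤ { i with res := b } ∧ { i with res := b } ≤ j :=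
  ⟨⟨le_rfl, hi, le_rfl⟩, h.1, hj, h.2.2⟩

theorem InColor.le_susp {i j : InColor} {b : Scott} (h : i ≤ j) (hi : i.susp ≤ b)
    (hj : b ≤ j.susp) : i ≤ { i with susp := b } ∧ { i with susp := b } ≤ j :=
  ⟨⟨le_rfl, le_rfl, hi⟩, h.1, h.2.1, hj⟩

section Start

variable {c : Colors} {s : S} {p q : MState S} {i : InColor}

/-- The input wires of the body may take over the values of their sources one by one:
all intermediate input colors are admissible, since the source color is. -/
theorem Coherent.suspend_setIn (h : Coherent E (.suspend c s p))
    (hi : p.inC ≤ i ∧ i ≤ ⟨c.inp.go, suspendRes E c s p, suspendSusp E c s p⟩) :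
    Coherent E (.suspend c s (p.setIn i)) := by
  have ⟨ha, _, hp, hs, _⟩ := h
  exact h.suspend_replace (hp.setIn_of_source hi.1 hi.2 (suspend_admissible ha hs _))
    (refines_setIn p i) (by simpa using hi.2)

/-- As for `suspend`, the wires of the source may be taken over one by one. -/
theorem Coherent.test_setIn_left (h : Coherent E (.test c s p q))
    (hi : p.inC ≤ i ∧ i ≤ ⟨c.inp.go.and (E.val s), c.inp.res, c.inp.susp⟩) :
    Coherent E (.test c s (p.setIn i) q) := by
  have ⟨ha, _, hp, hq, hs, _, _, hj, _⟩ := h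
  exact h.test_replace
    (hp.setIn_of_source hi.1 hi.2 (test_admissible ha hs (Or.inl rfl) _)) hq
    (refines_setIn p i) (.refl q) (by simpa using hi.2) hj

theorem Coherent.test_setIn_right (h : Coherent E (.test c s p q))
    (hi : q.inC ≤ i ∧ i ≤ ⟨c.inp.go.and (E.val s).not, c.inp.res, c.inp.susp⟩) :
    Coherent E (.test c s p (q.setIn i)) := by
  have ⟨ha, _, hp, hq, hs, _, hi', _, _⟩ := h
  exact h.test_replace hp
    (hq.setIn_of_source hi.1 hi.2 (test_admissible ha hs (Or.inr rfl) _))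
    (.refl p) (refines_setIn q i) hi' (by simpa using hi.2)

theorem Coherent.seq_setIn_right (h : Coherent E (.seq c p q))
    (hi : q.inC ≤ i ∧ i ≤ ⟨seqGo p.outC, c.inp.res, c.inp.susp⟩) :
    Coherent E (.seq c p (q.setIn i)) := by
  have ⟨ha, hp, hq, hs, hex, hi', _, _⟩ := h
  exact h.seq_replace hp
    (hq.setIn_of_source hi.1 hi.2 (seq_admissible hp ha hs hex hi' _))
    (.refl p) (refines_setIn q i) hi' (by simpa using hi.2)

end Start

/-- Start and context rules replace a part, end rules move the output color to its source
value, and rules of atomic statements move it towards the value determined by the inputs. -/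
theorem Coherent.step {p p' : MState S} (h : Coherent E p) (hst : Step E p p') :
    Coherent E p' := by
  induction hst
  case nothing_nogo hg ho | nothing_go hg ho | exit_nogo hg ho | exit_go hg ho =>
    exact ⟨h.1, h.2.1, h.2.2.set_out (by simp [ho]) (by simp [hg, leafOut])⟩
  case emit_nogo hg ho | emit_go hg ho =>
    exact ⟨h.1, h.2.1, h.2.2.1, h.2.2.2.set_out (by simp [ho]) (by simp [hg, leafOut])⟩
  case pause_not0 c K hr ho h0 =>
    refine ⟨h.1, h.2.set_out (by simp [ho]) ?_⟩
    have hle := h.2.2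
    rw [ho] at hle
    -- The wire 0 that is cut cannot be the one that is going to be 1.
    have hres : ¬ (c.sel = true ∧ c.inp.res = .pos ∧ c.inp.susp = .neg) := by
      rintro ⟨h₁, h₂, -⟩
      simp [h₁, h₂] at hr
    simp only [pauseOut, hr, hres, if_true, if_false] at hle ⊢
    split_ifs at hle ⊢ <;> simp_all
  case pause_not1 c K hg ho h1 =>
    refine ⟨h.1, h.2.set_out (by simp [ho]) ?_⟩
    have hle := h.2.2
    rw [ho] at hle
    simp only [pauseOut, hg, if_true, reduceCtorEq, if_false] at hle ⊢
    split_ifs at hle ⊢ <;> simp_all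
  case pause_go c hg ho =>
    exact ⟨h.1, h.2.set_out ho.le (by simp [pauseOut, hg])⟩
  case pause_res c hs hr hu ho =>
    have hg : c.inp.go ≠ .pos := fun hg => h.1.1 ⟨hs, hg⟩
    exact ⟨h.1, h.2.set_out ho.le (by simp [pauseOut, hg, hs, hr, hu])⟩
  case await_not0 E c s K hn ho h0 =>
    refine ⟨h.1, h.2.1, h.2.2.set_out (by simp [ho]) ?_⟩
    have hle := h.2.2.2
    rw [ho] at hle
    have hres : ¬ (c.GoRes ∧ E.val s = .pos) := by
      rintro ⟨h₁, h₂⟩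
      rcases hn with hn | hn
      · exact h₁.not_noGoRes hn
      · simp [h₂] at hn
    simp only [awaitOut, hres, if_false] at hle ⊢
    split_ifs at hle ⊢ <;> simp_all
  case await_not1 E c s K hn ho h1 =>
    refine ⟨h.1, h.2.1, h.2.2.set_out (by simp [ho]) ?_⟩
    have hle := h.2.2.2
    rw [ho] at hle
    have hres : ¬ (c.GoRes ∧ E.val s = .neg) := by
      rintro ⟨h₁, h₂⟩
      rcases hn with hn | hn
      · exact h₁.not_noGoRes hn
      · simp [h₂] at hn
    simp only [awaitOut, hres, if_false] at hle ⊢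
    split_ifs at hle ⊢ <;> simp_all
  case await_wait hg hb ho =>
    exact ⟨h.1, h.2.1, h.2.2.set_out ho.le (by simp [awaitOut, hg, hb])⟩
  case await_done hg hb ho =>
    exact ⟨h.1, h.2.1, h.2.2.set_out ho.le (by simp [awaitOut, hg, hb])⟩
  case trap_start E c p hlt =>
    have ⟨ha, hp, hs, _⟩ := h
    exact h.trap_replace (hp.setIn hlt.le (ha.of_le (fun h => hs.trans h) le_rfl))
      (refines_setIn p _) (by simp)
  case trap_ctx hst ih =>
    obtain ⟨hi, r⟩ := hst.inC_eq_and_refines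
    exact h.trap_replace (ih h.2.1) r (hi.trans_le h.2.2.2.1)
  case trap_end hlt | shift_end hlt =>
    have ⟨ha, hp, hs, hi, ho⟩ := h
    exact ⟨ha, hp, hs, hi, ho.set_out hlt.le le_rfl⟩
  case shift_start E c p hlt =>
    have ⟨ha, hp, hs, _⟩ := h
    exact h.shift_replace (hp.setIn hlt.le (ha.of_le (fun h => hs.trans h) le_rfl))
      (refines_setIn p _) (by simp)
  case shift_ctx hst ih =>
    obtain ⟨hi, r⟩ := hst.inC_eq_and_refines
    exact h.shift_replace (ih h.2.1) r (hi.trans_le h.2.2.2.1)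
  case suspend_go hlt =>
    exact h.suspend_setIn (InColor.le_go h.2.2.2.2.1 hlt.le le_rfl)
  case suspend_res hlt =>
    exact h.suspend_setIn (InColor.le_res h.2.2.2.2.1 hlt.le le_rfl)
  case suspend_susp hlt =>
    exact h.suspend_setIn (InColor.le_susp h.2.2.2.2.1 hlt.le le_rfl)
  case suspend_ctx hst ih =>
    obtain ⟨hi, r⟩ := hst.inC_eq_and_refines
    exact h.suspend_replace (ih h.2.2.1) r (hi.trans_le h.2.2.2.2.1)
  case suspend_end_unknown hlt =>
    have ⟨ha, hd, hp, hs, hi, ho⟩ := h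
    exact ⟨ha, hd, hp, hs, hi,
      ho.set_out hlt.le (suspNow_mono_left (Scott.bot_le _) _)⟩
  case suspend_end hlt =>
    have ⟨ha, hd, hp, hs, hi, ho⟩ := h
    exact ⟨ha, hd, hp, hs, hi, ho.set_out hlt.le le_rfl⟩
  case test_goL hlt =>
    exact h.test_setIn_left (InColor.le_go h.2.2.2.2.2.2.1 hlt.le le_rfl)
  case test_goR hlt =>
    exact h.test_setIn_right (InColor.le_go h.2.2.2.2.2.2.2.1 hlt.le le_rfl)
  case test_resL hlt =>
    exact h.test_setIn_left (InColor.le_res h.2.2.2.2.2.2.1 hlt.le le_rfl)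
  case test_resR hlt =>
    exact h.test_setIn_right (InColor.le_res h.2.2.2.2.2.2.2.1 hlt.le le_rfl)
  case test_suspL hlt =>
    exact h.test_setIn_left (InColor.le_susp h.2.2.2.2.2.2.1 hlt.le le_rfl)
  case test_suspR hlt =>
    exact h.test_setIn_right (InColor.le_susp h.2.2.2.2.2.2.2.1 hlt.le le_rfl)
  case test_ctxL hst ih =>
    obtain ⟨hi', r⟩ := hst.inC_eq_and_refines
    have ⟨_, _, hp, hq, _, _, hi, hj, _⟩ := h
    exact h.test_replace (ih hp) hq r (.refl _) (hi'.trans_le hi) hj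
  case test_ctxR hst ih =>
    obtain ⟨hj', r⟩ := hst.inC_eq_and_refines
    have ⟨_, _, hp, hq, _, _, hi, hj, _⟩ := h
    exact h.test_replace hp (ih hq) (.refl _) r hi (hj'.trans_le hj)
  case test_end hlt =>
    have ⟨ha, hd, hp, hq, hs, hex, hi, hj, ho⟩ := h
    exact ⟨ha, hd, hp, hq, hs, hex, hi, hj, ho.set_out hlt.le le_rfl⟩
  case seq_startL E c p q hlt =>
    have ⟨ha, hp, hq, hs, _, _, hj, _⟩ := h
    exact h.seq_replace
      (hp.setIn hlt.le (ha.of_le (fun h => hs.trans (by simp_all)) le_rfl)) hq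
      (refines_setIn p _) (.refl q) (by simp) hj
  case seq_resR hlt =>
    exact h.seq_setIn_right (InColor.le_res h.2.2.2.2.2.2.1 hlt.le le_rfl)
  case seq_suspR hlt =>
    exact h.seq_setIn_right (InColor.le_susp h.2.2.2.2.2.2.1 hlt.le le_rfl)
  case seq_goR hp hq =>
    exact h.seq_setIn_right (InColor.le_go h.2.2.2.2.2.2.1 (Or.inl hq)
      (seqGo_eq_pos.2 hp).ge)
  case seq_nogoR hp hq =>
    exact h.seq_setIn_right (InColor.le_go h.2.2.2.2.2.2.1 (Or.inl hq)
      (seqGo_eq_neg.2 hp).ge)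
  case seq_ctxL hst ih =>
    obtain ⟨hi', r⟩ := hst.inC_eq_and_refines
    have ⟨_, hp, hq, _, _, hi, hj, _⟩ := h
    exact h.seq_replace (ih hp) hq r (.refl _) (hi'.trans_le hi) hj
  case seq_ctxR hst ih =>
    obtain ⟨hj', r⟩ := hst.inC_eq_and_refines
    have ⟨_, hp, hq, _, _, hi, hj, _⟩ := h
    exact h.seq_replace hp (ih hq) (.refl _) r hi (hj'.trans_le hj)
  case seq_end hlt =>
    have ⟨ha, hp, hq, hs, hex, hi, hj, ho⟩ := h
    exact ⟨ha, hp, hq, hs, hex, hi, hj, ho.set_out hlt.le le_rfl⟩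
  case par_startL E c p q hlt =>
    have ⟨ha, hp, hq, hs, _, hj, _⟩ := h
    exact h.par_replace
      (hp.setIn hlt.le (ha.of_le (fun h => hs.trans (by simp_all)) le_rfl)) hq
      (refines_setIn p _) (.refl q) (by simp) hj
  case par_startR E c p q hlt =>
    have ⟨ha, hp, hq, hs, hi, _, _⟩ := h
    exact h.par_replace hp
      (hq.setIn hlt.le (ha.of_le (fun h => hs.trans (by simp_all)) le_rfl))
      (.refl p) (refines_setIn q _) hi (by simp)
  case par_ctxL hst ih =>
    obtain ⟨hi', r⟩ := hst.inC_eq_and_refines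
    have ⟨_, hp, hq, _, hi, hj, _⟩ := h
    exact h.par_replace (ih hp) hq r (.refl _) (hi'.trans_le hi) hj
  case par_ctxR hst ih =>
    obtain ⟨hj', r⟩ := hst.inC_eq_and_refines
    have ⟨_, hp, hq, _, hi, hj, _⟩ := h
    exact h.par_replace hp (ih hq) (.refl _) r hi (hj'.trans_le hj)
  case par_end hlt =>
    have ⟨ha, hp, hq, hs, hi, hj, ho⟩ := h
    exact ⟨ha, hp, hq, hs, hi, hj, ho.set_out hlt.le le_rfl⟩
  case signal_start E c s p hlt =>
    have ⟨ha, hp, hs, _⟩ := h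
    exact h.signal_replace (hp.setIn hlt.le (ha.of_le (fun h => hs.trans h) le_rfl))
      (refines_setIn p _) (by simp)
  case signal_ctx hst ih =>
    obtain ⟨hi, r⟩ := hst.inC_eq_and_refines
    exact h.signal_replace (ih h.2.1) r (hi.trans_le h.2.2.2.1)
  case signal_end hlt =>
    have ⟨ha, hp, hs, hi, ho⟩ := h
    exact ⟨ha, hp, hs, hi, ho.set_out hlt.le le_rfl⟩

end

section

open OutColor MState

/-! ### Initial microstates -/

section Initial

variable {S : Type*}

@[simp] theorem inC_fromCmd (p : Cmd S) : (fromCmd p).inC = .unknown := by cases p <;> rfl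

@[simp] theorem sel_fromCmd (p : Cmd S) : (fromCmd p).sel = false := by cases p <;> rfl

@[simp] theorem outC_fromCmd (p : Cmd S) : (fromCmd p).outC = white p.codes := by
  cases p <;> rfl

@[simp] theorem base_fromCmd (p : Cmd S) : (fromCmd p).base = p := by
  induction p <;> simp_all [fromCmd, base]

@[simp] theorem codes_fromCmd (p : Cmd S) : (fromCmd p).codes = p.codes :=
  congrArg Cmd.codes (base_fromCmd p)

@[simp] theorem inC_fromState (p : AState S) : (fromState p).inC = .unknown := by
  cases p <;> rfl

@[simp] theorem sel_fromState (p : AState S) : (fromState p).sel = true := by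
  cases p <;> rfl

@[simp] theorem outC_fromState (p : AState S) :
    (fromState p).outC = white p.base.codes := by
  cases p <;> rfl

@[simp] theorem base_fromState (p : AState S) : (fromState p).base = p.base := by
  induction p <;> simp_all [fromState, base, AState.base]

@[simp] theorem codes_fromState (p : AState S) : (fromState p).codes = p.base.codes :=
  congrArg Cmd.codes (base_fromState p)

theorem admissible_initColors (σ : Bool) (K : Finset ℕ) : (initColors σ K).Admissible := by
  simp [initColors, Colors.Admissible, InColor.unknown]

theorem outBetween_initColors {σ : Bool} {K : Finset ℕ} {o : OutColor} (h : white K ≤ o) :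
    (initColors σ K).OutBetween K o := ⟨le_rfl, h⟩

theorem white_le_pauseOut (c : Colors) : white {0, 1} ≤ pauseOut c := by
  unfold pauseOut
  split_ifs <;> simp

theorem white_le_awaitOut (c : Colors) (b : Scott) : white {0, 1} ≤ awaitOut c b := by
  unfold awaitOut
  split_ifs <;> simp

/-- An undetermined suspension adds code 1 to the possible codes, which gives exactly the
static codes of `suspend`; knowing more about the suspension only adds information. -/
theorem white_le_suspNow (u : Scott) (K : Finset ℕ) :
    white ({1} ∪ K) ≤ suspNow u (white K) :=
  (le_refl (suspNow .bot (white K))).trans (suspNow_mono_left (Scott.bot_le u) _)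

end Initial

variable {S : Type*} [DecidableEq S] {E E' : Event S}

theorem Event.subset_add_dom {A : Set S} {s : S} {b : Scott} (h : A \ {s} ⊆ E.dom) :
    A ⊆ (E.add s b).dom := by
  rw [Event.add_dom]
  intro t ht
  by_cases hts : t = s
  · exact Or.inl hts
  · exact Or.inr (h ⟨ht, hts⟩)

/-- A coherent microstate whose root carries no information beyond the static codes. -/
structure Initial (E : Event S) (p : MState S) : Prop where
  coherent : Coherent E p
  inC_eq : p.inC = .unknown
  outC_eq : p.outC = white p.codes

namespace Initial

variable {p q : MState S} {s : S}

theorem inC_le (h : Initial E p) (i : InColor) : p.inC ≤ i :=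
  h.inC_eq ▸ InColor.unknown_le i

theorem trap (h : Initial E p) :
    Initial E (.trap (initColors p.sel (p.codes.image downCode)) p) :=
  ⟨⟨admissible_initColors _ _, h.coherent, rfl, h.inC_le _,
    outBetween_initColors (by rw [h.outC_eq]; exact le_rfl)⟩, rfl, rfl⟩

theorem shift (h : Initial E p) :
    Initial E (.shift (initColors p.sel (p.codes.image upCode)) p) :=
  ⟨⟨admissible_initColors _ _, h.coherent, rfl, h.inC_le _,
    outBetween_initColors (by rw [h.outC_eq]; exact le_rfl)⟩, rfl, rfl⟩

theorem suspend (hs : s ∈ E.dom) (h : Initial E p) :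
    Initial E (.suspend (initColors p.sel ({1} ∪ p.codes)) s p) :=
  ⟨⟨admissible_initColors _ _, hs, h.coherent, rfl, h.inC_le _,
    outBetween_initColors (by rw [h.outC_eq]; exact white_le_suspNow _ _)⟩, rfl, rfl⟩

theorem test (hs : s ∈ E.dom) (h : Initial E p) (h' : Initial E q)
    (hex : ¬ (p.sel = true ∧ q.sel = true)) :
    Initial E (.test (initColors (p.sel || q.sel) (p.codes ∪ q.codes)) s p q) :=
  ⟨⟨admissible_initColors _ _, hs, h.coherent, h'.coherent, rfl, hex, h.inC_le _,
    h'.inC_le _, outBetween_initColors (by rw [h.outC_eq, h'.outC_eq]; exact le_rfl)⟩,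
    rfl, rfl⟩

theorem seq (h : Initial E p) (h' : Initial E q) (hex : ¬ (p.sel = true ∧ q.sel = true)) :
    Initial E (.seq (initColors (p.sel || q.sel) ((p.codes \ {0}) ∪ q.codes)) p q) :=
  ⟨⟨admissible_initColors _ _, h.coherent, h'.coherent, rfl, hex, h.inC_le _,
    h'.inC_le _, outBetween_initColors (by rw [h.outC_eq, h'.outC_eq]; exact le_rfl)⟩,
    rfl, rfl⟩

theorem par (h : Initial E p) (h' : Initial E q) :
    Initial E (.par (initColors (p.sel || q.sel)
      (p.codes ∪ q.codes ∪ maxCodes p.codes q.codes)) p q) :=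
  ⟨⟨admissible_initColors _ _, h.coherent, h'.coherent, rfl, h.inC_le _,
    h'.inC_le _, outBetween_initColors (by rw [h.outC_eq, h'.outC_eq]; exact le_rfl)⟩,
    rfl, rfl⟩

theorem signal (h : Initial (E.add s (p.localStatus s E)) p) :
    Initial E (.signal (initColors p.sel p.codes) s p) :=
  ⟨⟨admissible_initColors _ _, h.coherent, rfl, h.inC_le _,
    outBetween_initColors h.outC_eq.ge⟩, rfl, rfl⟩

end Initial

theorem initial_fromCmd {p : Cmd S} (h : p.free ⊆ E.dom) : Initial E (fromCmd p) := by
  induction p generalizing E with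
  | nothing | exit n =>
    exact ⟨⟨admissible_initColors _ _, rfl, outBetween_initColors le_rfl⟩, rfl, rfl⟩
  | pause =>
    exact ⟨⟨admissible_initColors _ _, outBetween_initColors (white_le_pauseOut _)⟩,
      rfl, rfl⟩
  | emit s =>
    exact ⟨⟨admissible_initColors _ _, h rfl, rfl, outBetween_initColors le_rfl⟩, rfl, rfl⟩
  | awaitImm s =>
    exact ⟨⟨admissible_initColors _ _, h rfl,
      outBetween_initColors (white_le_awaitOut _ _)⟩, rfl, rfl⟩
  | trap p ih => simpa [fromCmd, Cmd.codes] using (ih h).trap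
  | shift p ih => simpa [fromCmd, Cmd.codes] using (ih h).shift
  | suspend s p ih =>
    simpa [fromCmd, Cmd.codes] using (ih fun t ht => h (Or.inr ht)).suspend (h (Or.inl rfl))
  | test s p q ihp ihq =>
    simpa [fromCmd, Cmd.codes] using Initial.test (h (Or.inl (Or.inl rfl)))
      (ihp fun t ht => h (Or.inl (Or.inr ht))) (ihq fun t ht => h (Or.inr ht)) (by simp)
  | seq p q ihp ihq =>
    simpa [fromCmd, Cmd.codes] using
      (ihp fun t ht => h (Or.inl ht)).seq (ihq fun t ht => h (Or.inr ht)) (by simp)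
  | par p q ihp ihq =>
    simpa [fromCmd, Cmd.codes] using
      (ihp fun t ht => h (Or.inl ht)).par (ihq fun t ht => h (Or.inr ht))
  | signal s p ih => simpa [fromCmd, Cmd.codes] using (ih (Event.subset_add_dom h)).signal

theorem initial_fromState {p : AState S} (h : p.base.free ⊆ E.dom) :
    Initial E (fromState p) := by
  induction p generalizing E with
  | pause =>
    exact ⟨⟨admissible_initColors _ _, outBetween_initColors (white_le_pauseOut _)⟩,
      rfl, rfl⟩
  | awaitImm s =>
    exact ⟨⟨admissible_initColors _ _, h rfl,
      outBetween_initColors (white_le_awaitOut _ _)⟩, rfl, rfl⟩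
  | trap p ih => simpa [fromState, Cmd.codes, AState.base] using (ih h).trap
  | shift p ih => simpa [fromState, Cmd.codes, AState.base] using (ih h).shift
  | suspend s p ih =>
    simpa [fromState, Cmd.codes, AState.base] using
      (ih fun t ht => h (Or.inr ht)).suspend (h (Or.inl rfl))
  | testL s p q ih =>
    simpa [fromState, Cmd.codes, AState.base] using Initial.test (h (Or.inl (Or.inl rfl)))
      (ih fun t ht => h (Or.inl (Or.inr ht)))
      (initial_fromCmd fun t ht => h (Or.inr ht)) (by simp)
  | testR s p q ih =>
    simpa [fromState, Cmd.codes, AState.base] using Initial.test (h (Or.inl (Or.inl rfl)))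
      (initial_fromCmd fun t ht => h (Or.inl (Or.inr ht)))
      (ih fun t ht => h (Or.inr ht)) (by simp)
  | seqL p q ih =>
    simpa [fromState, Cmd.codes, AState.base] using (ih fun t ht => h (Or.inl ht)).seq
      (initial_fromCmd fun t ht => h (Or.inr ht)) (by simp)
  | seqR p q ih =>
    simpa [fromState, Cmd.codes, AState.base] using
      Initial.seq (initial_fromCmd fun t ht => h (Or.inl ht))
      (ih fun t ht => h (Or.inr ht)) (by simp)
  | parL p q ih =>
    simpa [fromState, Cmd.codes, AState.base] using (ih fun t ht => h (Or.inl ht)).par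
      (initial_fromCmd fun t ht => h (Or.inr ht))
  | parR p q ih =>
    simpa [fromState, Cmd.codes, AState.base] using
      Initial.par (initial_fromCmd fun t ht => h (Or.inl ht))
      (ih fun t ht => h (Or.inr ht))
  | parB p q ihp ihq =>
    simpa [fromState, Cmd.codes, AState.base] using
      (ihp fun t ht => h (Or.inl ht)).par (ihq fun t ht => h (Or.inr ht))
  | signal s p ih =>
    simpa [fromState, Cmd.codes, AState.base] using
      (ih (Event.subset_add_dom h)).signal

theorem Initial.vc {p : MState S} (h : Initial E p) : VC E p :=
  ⟨h.coherent, by simp [h.inC_eq, InColor.unknown]⟩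

theorem Initial.vc_setIn {p : MState S} {i : InColor} (h : Initial E p)
    (hg : p.sel = true → i.go ≠ .pos) (hu : i.susp ≠ .pos) : VC E (p.setIn i) :=
  ⟨h.coherent.setIn (h.inC_le i) ⟨fun h => hg h.1 h.2, fun h => absurd h hu⟩, by simpa⟩

/-! ### Comparison with the starting microstate -/

theorem initColors_le {c : Colors} {σ : Bool} {K K' : Finset ℕ} {o : OutColor}
    (hs : σ = c.sel) (hK : K = K') (ho : c.OutBetween K' o) : (initColors σ K).Le c :=
  ⟨hs, InColor.unknown_le _, hK ▸ ho.1⟩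

/-- The statement is preserved by `backToTerm` and Sel tells the states, so that no test or
sequence falls under the default cases of `backToTerm`. The output color of every node
carries at least the static information of the initial microstate. -/
theorem Coherent.fromTerm_backToTerm {p : MState S} (h : Coherent E p) :
    (fromTerm (backToTerm p)).base = p.base ∧ (fromTerm (backToTerm p)).sel = p.sel ∧
      fromTerm (backToTerm p) ≤ p := by
  induction p generalizing E with
  | nothing c =>
    obtain ⟨-, hs, ho⟩ := h
    exact ⟨rfl, hs.symm, .nothing (initColors_le hs.symm rfl ho)⟩
  | exit c n =>
    obtain ⟨-, hs, ho⟩ := h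
    exact ⟨rfl, hs.symm, .exit (initColors_le hs.symm rfl ho)⟩
  | emit c s =>
    obtain ⟨-, -, hs, ho⟩ := h
    exact ⟨rfl, hs.symm, .emit (initColors_le hs.symm rfl ho)⟩
  | pause c =>
    obtain ⟨-, ho⟩ := h
    cases hs : c.sel <;> simp only [backToTerm, hs, Bool.false_eq_true, if_true, if_false] <;>
      exact ⟨rfl, hs.symm, .pause (initColors_le hs.symm rfl ho)⟩
  | awaitImm c s =>
    obtain ⟨-, -, ho⟩ := h
    cases hs : c.sel <;> simp only [backToTerm, hs, Bool.false_eq_true, if_true, if_false] <;>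
      exact ⟨rfl, hs.symm, .awaitImm (initColors_le hs.symm rfl ho)⟩
  | trap c p ih =>
    obtain ⟨-, hp, hs, -, ho⟩ := h
    obtain ⟨hb, hsp, hle⟩ := ih hp
    simp only [backToTerm, MState.codes] at *
    cases hp' : backToTerm p <;>
      simp only [hp', fromTerm, base_fromCmd, base_fromState, sel_fromCmd, sel_fromState]
        at hb hsp hle ⊢ <;>
      exact ⟨by simp [base, hb, AState.base], hsp.trans hs.symm,
        .trap (initColors_le (hsp.trans hs.symm)
          (by simp [hb, Cmd.codes, AState.base]) ho) hle⟩
  | shift c p ih =>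
    obtain ⟨-, hp, hs, -, ho⟩ := h
    obtain ⟨hb, hsp, hle⟩ := ih hp
    simp only [backToTerm, MState.codes] at *
    cases hp' : backToTerm p <;>
      simp only [hp', fromTerm, base_fromCmd, base_fromState, sel_fromCmd, sel_fromState]
        at hb hsp hle ⊢ <;>
      exact ⟨by simp [base, hb, AState.base], hsp.trans hs.symm,
        .shift (initColors_le (hsp.trans hs.symm)
          (by simp [hb, Cmd.codes, AState.base]) ho) hle⟩
  | suspend c s p ih =>
    obtain ⟨-, -, hp, hs, -, ho⟩ := h
    obtain ⟨hb, hsp, hle⟩ := ih hp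
    simp only [backToTerm, MState.codes] at *
    cases hp' : backToTerm p <;>
      simp only [hp', fromTerm, base_fromCmd, base_fromState, sel_fromCmd, sel_fromState]
        at hb hsp hle ⊢ <;>
      exact ⟨by simp [base, hb, AState.base], hsp.trans hs.symm,
        .suspend (initColors_le (hsp.trans hs.symm)
          (by simp [hb, Cmd.codes, AState.base]) ho) hle⟩
  | test c s p q ihp ihq =>
    obtain ⟨-, -, hp, hq, hs, hex, -, -, ho⟩ := h
    obtain ⟨hbp, hsp, hlep⟩ := ihp hp
    obtain ⟨hbq, hsq, hleq⟩ := ihq hq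
    simp only [backToTerm, MState.codes] at *
    rw [← hsp, ← hsq] at hs hex
    cases hp' : backToTerm p <;> cases hq' : backToTerm q <;>
      simp only [hp', hq', fromTerm, base_fromCmd, base_fromState, sel_fromCmd, sel_fromState]
        at hbp hbq hex hs hlep hleq ⊢
    case state.state => exact absurd ⟨trivial, trivial⟩ hex
    all_goals
      exact ⟨by simp [base, hbp, hbq, AState.base], hs.symm,
        .test (initColors_le hs.symm (by simp [hbp, hbq, Cmd.codes, AState.base]) ho)
          hlep hleq⟩
  | seq c p q ihp ihq =>
    obtain ⟨-, hp, hq, hs, hex, -, -, ho⟩ := h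
    obtain ⟨hbp, hsp, hlep⟩ := ihp hp
    obtain ⟨hbq, hsq, hleq⟩ := ihq hq
    simp only [backToTerm, MState.codes] at *
    rw [← hsp, ← hsq] at hs hex
    cases hp' : backToTerm p <;> cases hq' : backToTerm q <;>
      simp only [hp', hq', fromTerm, base_fromCmd, base_fromState, sel_fromCmd, sel_fromState]
        at hbp hbq hex hs hlep hleq ⊢
    case state.state => exact absurd ⟨trivial, trivial⟩ hex
    all_goals
      exact ⟨by simp [base, hbp, hbq, AState.base], hs.symm,
        .seq (initColors_le hs.symm (by simp [hbp, hbq, Cmd.codes, AState.base]) ho)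
          hlep hleq⟩
  | par c p q ihp ihq =>
    obtain ⟨-, hp, hq, hs, -, -, ho⟩ := h
    obtain ⟨hbp, hsp, hlep⟩ := ihp hp
    obtain ⟨hbq, hsq, hleq⟩ := ihq hq
    simp only [backToTerm, MState.codes] at *
    rw [← hsp, ← hsq] at hs
    cases hp' : backToTerm p <;> cases hq' : backToTerm q <;>
      simp only [hp', hq', fromTerm, base_fromCmd, base_fromState, sel_fromCmd, sel_fromState]
        at hbp hbq hs hlep hleq ⊢
    all_goals
      exact ⟨by simp [base, hbp, hbq, AState.base], hs.symm,
        .par (initColors_le hs.symm (by simp [hbp, hbq, Cmd.codes, AState.base]) ho)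
          hlep hleq⟩
  | signal c s p ih =>
    obtain ⟨-, hp, hs, -, ho⟩ := h
    obtain ⟨hb, hsp, hle⟩ := ih hp
    simp only [backToTerm, MState.codes] at *
    cases hp' : backToTerm p <;>
      simp only [hp', fromTerm, base_fromCmd, base_fromState, sel_fromCmd, sel_fromState]
        at hb hsp hle ⊢ <;>
      exact ⟨by simp [base, hb, AState.base], hsp.trans hs.symm,
        .signal (initColors_le (hsp.trans hs.symm)
          (by simp [hb, Cmd.codes, AState.base]) ho) hle⟩

end

end Esterel

theorem mainTheorem8 {S : Type*} [DecidableEq S] :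
    -- the initial microstates are well-colored, without input and for all starting inputs
    (∀ (E : Esterel.Event S) (p : Esterel.Cmd S), p.free ⊆ E.dom →
      Esterel.VC E (Esterel.fromCmd p) ∧
      ∀ i : Esterel.InColor, i.susp ≠ .pos →
        Esterel.VC E ((Esterel.fromCmd p).setIn i)) ∧
    (∀ (E : Esterel.Event S) (p : Esterel.AState S), p.base.free ⊆ E.dom →
      Esterel.VC E (Esterel.fromState p) ∧
      ∀ i : Esterel.InColor, i.go ≠ .pos → i.susp ≠ .pos →
        Esterel.VC E ((Esterel.fromState p).setIn i)) ∧
    -- microsteps preserve well-coloredness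
    (∀ (E : Esterel.Event S) (p p' : Esterel.MState S),
      Esterel.VC E p → Esterel.Step E p p' → Esterel.VC E p') ∧
    -- monotonicity in the event
    (∀ (E E' : Esterel.Event S) (p : Esterel.MState S),
      E.dom = E'.dom → E ≤ E' → Esterel.VC E p → Esterel.VC E' p) ∧
    -- control is only propagated
    (∀ (E : Esterel.Event S) (p : Esterel.MState S) (k : ℕ),
      Esterel.VC E p → p.outC = .black k → p.colors.GoRes) ∧
    (∀ (E : Esterel.Event S) (p : Esterel.MState S),
      Esterel.VC E p → p.outC = .white ∅ → p.colors.NoGoRes) ∧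
    -- the branches of a test and the parts of a sequence are not simultaneously active
    (∀ (E : Esterel.Event S) (c : Esterel.Colors) (s : S) (p q : Esterel.MState S),
      Esterel.VC E (.test c s p q) → ¬ p.colors.GoRes ∨ ¬ q.colors.GoRes) ∧
    (∀ (E : Esterel.Event S) (c : Esterel.Colors) (p q : Esterel.MState S),
      Esterel.VC E (.seq c p q) →
        (¬ p.outC.minusZero.IsBlack ∨ ¬ q.outC.IsBlack) ∧
        (¬ p.outC.minusZero.IsBlack ∨ ¬ q.colors.GoRes)) ∧
    -- comparison with the starting microstate
    (∀ (E : Esterel.Event S) (p : Esterel.MState S),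
      Esterel.VC E p → Esterel.fromTerm (Esterel.backToTerm p) ≤ p) := by
  refine ⟨fun E p h => ?_, fun E p h => ?_, fun E p p' h hst => ?_, fun E E' p hd hE h =>
    ⟨h.1.event_mono hd hE, h.2⟩, fun E p k h hk => ?_, fun E p h ho => h.1.noGoRes ho,
    fun E c s p q h => ?_, fun E c p q h => ?_, fun E p h => h.1.fromTerm_backToTerm.2.2⟩
  · have hi := Esterel.initial_fromCmd h
    exact ⟨hi.vc, fun i hu => hi.vc_setIn (by simp) hu⟩
  · have hi := Esterel.initial_fromState h
    exact ⟨hi.vc, fun i hg hu => hi.vc_setIn (fun _ => hg) hu⟩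
  · exact ⟨h.1.step hst, hst.inC_eq_and_refines.1.symm ▸ h.2⟩
  · exact (h.1.activeWith hk).resolve_right fun hu => h.2 hu.1
  · obtain ⟨⟨ha, -, -, -, hs, hex, hi, hj, -⟩, -⟩ := h
    exact not_and_or.1 (Esterel.test_not_goRes ha hs hex hi hj)
  · obtain ⟨⟨ha, hp, hq, hs, hex, hi, hj, -⟩, hu⟩ := h
    have hno : p.outC.minusZero.IsBlack → ¬ q.colors.GoRes := by
      rintro ⟨k, hk⟩ hgq
      have hap := hp.activeWith (Esterel.OutColor.minusZero_eq_black.1 hk).1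
      have hgp := hap.resolve_right fun h => hu (Esterel.Scott.le_pos_of_pos hi.2.2 h.1)
      exact Esterel.seq_not_goRes ha hs hex hi hj hk ⟨hgp, hgq⟩
    refine ⟨not_and_or.1 fun ⟨hbp, l, hl⟩ => hno hbp ?_, not_and_or.1 fun h => hno h.1 h.2⟩
    exact (hq.activeWith hl).resolve_right fun h =>
      hu (Esterel.Scott.le_pos_of_pos hj.2.2 h.1)
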